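/- Let $N\ge 1$ and let $h_1,\dots,h_N\in\mathbb{C}$ be window weights with $\sum_{n=1}^N|h_n|^2=1$. For $\omega\in\mathbb{R}$ let $$\mathbf{x}(\omega)=\big(h_n e^{j\omega(n-(N+1)/2)}\big)_{n=1}^{N}\in\mathbb{C}^N,\qquad H(\omega)=\sum_{n=1}^N|h_n|^2e^{j\omega(n-(N+1)/2)} .$$ Put $\tau=1/\Vert d\mathbf{x}(\omega)/d\omega\Vert$ (which does not depend on $\omega$), $\chi=|dH(0)/d\omega|$, $\alpha=1/(N\tau)$ and $\zeta=-\frac{N^{-2}}{2}\,\frac{d^2|H(\omega)|^2}{d\omega^2}\big|_{\omega=0}$. For every constant $D<1$ there are constants $C,c>0$, depending only on $D$, such that the following holds. Suppose that (i) the side-lobes of $|H|^2$ are smaller than $D$, that is, $|H(\omega)|^2<D$ at every local maximum $\omega\notin 2\pi\mathbb{Z}$ of $|H|^2$ (note that $|H|^2$ has period $2\pi$ and $|H(0)|^2=1$), and (ii) $|H|^2$ is non-increasing on $(0,\pi/(2N))$. Let $\epsilon>0$, and let $A$ be a random $M\times N$ matrix with entries i.i.d. uniform on $\{\pm1/\sqrt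 N,\pm j/\sqrt N\}$, where $$M\ \ge\ C\,\epsilon^{-2}\log\!\big(N\epsilon^{-1}(1-\tau\chi)^{-1}\zeta^{-1}\alpha^{-1}\big).$$ Then, with probability at least $1-e^{-c\epsilon^2M}$, $$1-\epsilon\ \le\ \sqrt{\frac NM}\;\frac{\Vert g_1A\mathbf{x}(\omega_1)-g_2A\mathbf{x}(\omega_2)\Vert}{\Vert g_1\mathbf{x}(\omega_1)-g_2\mathbf{x}(\omega_2)\Vert}\ \le\ 1+\epsilon$$ simultaneously for all $g_1,g_2\in\mathbb{C}$ and all $\omega_1,\omega_2\in\mathbb{R}$ for which the denominator is not zero. -/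

import Mathlib

open Complex MeasureTheory ProbabilityTheory

noncomputable section

/-- Centred position `n - (N + 1) / 2` of the `n`-th sample, `n = 1, …, N`; the index `i : Fin N`
stands for `n = i + 1`. -/
def centredPos (N : ℕ) (i : Fin N) : ℝ := ((i : ℕ) + 1 : ℝ) - ((N : ℝ) + 1) / 2

/-- The windowed sinusoid of frequency `ω`, with entries `h_n exp (j ω (n - (N + 1) / 2))`. -/
def windowedSinusoid {N : ℕ} (h : Fin N → ℂ) (ω : ℝ) : EuclideanSpace ℂ (Fin N) :=
  WithLp.toLp 2 fun i => h i * exp (I * (ω : ℂ) * (centredPos N i : ℂ))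

/-- The window spectrum `H(ω) = ∑ₙ |h_n|² exp (j ω (n - (N + 1) / 2))`. -/
def windowSpectrum {N : ℕ} (h : Fin N → ℂ) (ω : ℝ) : ℂ :=
  ∑ i, ((‖h i‖ ^ 2 : ℝ) : ℂ) * exp (I * (ω : ℂ) * (centredPos N i : ℂ))

/-- `|H(ω)|²`. -/
def windowPower {N : ℕ} (h : Fin N → ℂ) (ω : ℝ) : ℝ := ‖windowSpectrum h ω‖ ^ 2

/-- `τ = 1 / ‖dx(ω)/dω‖`, evaluated at `ω = 0`; it is the same at every frequency, see
`windowTau_eq`. -/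
def windowTau {N : ℕ} (h : Fin N → ℂ) : ℝ := 1 / ‖deriv (windowedSinusoid h) 0‖

/-- `χ = |dH(0)/dω|`. -/
def windowChi {N : ℕ} (h : Fin N → ℂ) : ℝ := ‖deriv (windowSpectrum h) 0‖

/-- `α = 1 / (N τ)`. -/
def windowAlpha {N : ℕ} (h : Fin N → ℂ) : ℝ := 1 / ((N : ℝ) * windowTau h)

/-- `ζ = -(N⁻² / 2) d²|H|²/dω²` at `ω = 0`. -/
def windowZeta {N : ℕ} (h : Fin N → ℂ) : ℝ :=
  -(((N : ℝ) ^ 2)⁻¹ / 2) * iteratedDeriv 2 (windowPower h) 0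

/-- The side-lobes of `|H|²` are smaller than `D`: every local maximum away from the main lobe peak
is. As `|H|²` has period `2π`, the frequency `0` is excluded modulo `2π`. -/
def SidelobesBelow {N : ℕ} (h : Fin N → ℂ) (D : ℝ) : Prop :=
  ∀ ω : ℝ, (∀ k : ℤ, ω ≠ 2 * Real.pi * k) → IsLocalMax (windowPower h) ω → windowPower h ω < D

/-- The alphabet `{±1/√N, ±j/√N}`. -/
def phaseAlphabet (N : ℕ) : Set ℂ :=
  {((1 / √(N : ℝ) : ℝ) : ℂ), -((1 / √(N : ℝ) : ℝ) : ℂ),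
    I * ((1 / √(N : ℝ) : ℝ) : ℂ), -(I * ((1 / √(N : ℝ) : ℝ) : ℂ))}

/-- `A` is a random `M × N` matrix with i.i.d. entries, uniform on `{±1/√N, ±j/√N}`. -/
structure IsRandomPhaseMatrix {Ω : Type*} [MeasurableSpace Ω] (P : Measure Ω) {M N : ℕ}
    (A : Ω → Matrix (Fin M) (Fin N) ℂ) : Prop where
  hasLaw : ∀ m n, HasLaw (fun s => A s m n) (uniformOn (phaseAlphabet N)) P
  indep : iIndepFun (fun (p : Fin M × Fin N) (s : Ω) => A s p.1 p.2) P

/-- `A` is a pairwise `ε`-isometry, up to the factor `√(M/N)`, for the manifold of all complex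
multiples of the windowed sinusoids. The ratio makes sense when its denominator is not zero (if
the denominator is zero, then so is the numerator). -/
def IsPairwiseIsometry {M N : ℕ} (A : Matrix (Fin M) (Fin N) ℂ) (h : Fin N → ℂ) (ε : ℝ) : Prop :=
  ∀ (g₁ g₂ : ℂ) (ω₁ ω₂ : ℝ),
    g₁ • windowedSinusoid h ω₁ - g₂ • windowedSinusoid h ω₂ ≠ 0 →
    1 - ε ≤ √((N : ℝ) / M) *
        (‖g₁ • Matrix.toEuclideanLin A (windowedSinusoid h ω₁) -
            g₂ • Matrix.toEuclideanLin A (windowedSinusoid h ω₂)‖ /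
          ‖g₁ • windowedSinusoid h ω₁ - g₂ • windowedSinusoid h ω₂‖) ∧
      √((N : ℝ) / M) *
        (‖g₁ • Matrix.toEuclideanLin A (windowedSinusoid h ω₁) -
            g₂ • Matrix.toEuclideanLin A (windowedSinusoid h ω₂)‖ /
          ‖g₁ • windowedSinusoid h ω₁ - g₂ • windowedSinusoid h ω₂‖) ≤ 1 + ε

/-- The derivative of the windowed sinusoid, entry by entry. -/
theorem hasDerivAt_windowedSinusoid {N : ℕ} (h : Fin N → ℂ) (ω : ℝ) :
    HasDerivAt (windowedSinusoid h)
      (WithLp.toLp 2 fun i =>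
        h i * (exp (I * (ω : ℂ) * (centredPos N i : ℂ)) * (I * (centredPos N i : ℂ)))) ω := by
  have hp : HasDerivAt (fun (t : ℝ) (i : Fin N) => h i * exp (I * (t : ℂ) * (centredPos N i : ℂ)))
      (fun i => h i * (exp (I * (ω : ℂ) * (centredPos N i : ℂ)) * (I * (centredPos N i : ℂ)))) ω := by
    rw [hasDerivAt_pi]
    intro i
    have h1 : HasDerivAt (fun t : ℝ => I * (t : ℂ) * (centredPos N i : ℂ))
        (I * (centredPos N i : ℂ)) ω := by
      simpa using (((hasDerivAt_id ω).ofReal_comp).const_mul I).mul_const (centredPos N i : ℂ)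
    exact (h1.cexp).const_mul (h i)
  exact (PiLp.hasFDerivAt_toLp (𝕜 := ℝ) 2 _).comp_hasDerivAt ω hp

/-- `‖dx(ω)/dω‖` does not depend on `ω`. -/
theorem windowTau_eq {N : ℕ} (h : Fin N → ℂ) (ω : ℝ) :
    windowTau h = 1 / ‖deriv (windowedSinusoid h) ω‖ := by
  have key : ∀ (t : ℝ) (i : Fin N), ‖exp (I * (t : ℂ) * (centredPos N i : ℂ))‖ = 1 := by
    intro t i
    rw [show I * (t : ℂ) * (centredPos N i : ℂ) = ((t * centredPos N i : ℝ) : ℂ) * I by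
      push_cast; ring]
    exact norm_exp_ofReal_mul_I _
  unfold windowTau
  rw [(hasDerivAt_windowedSinusoid h 0).deriv, (hasDerivAt_windowedSinusoid h ω).deriv,
    EuclideanSpace.norm_eq, EuclideanSpace.norm_eq]
  simp only [norm_mul, key]

end

/-! The proof is a net argument on the unit secants of the manifold, that is, on the normalized
differences of two scaled sinusoids, combined with norm concentration for a fixed vector.

Concentration (`matrixEnergy_tail`): for a fixed unit vector, each row product has sub-Gaussian real
and imaginary parts. Hence its squared modulus has mean one and an exponential moment, and
Chernoff's bound over the independent rows gives failure probability at most `2 exp (-t² M / 1024)`.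

Net (`exists_secant_net`): a difference `g₁ x(ω) - g₂ x(ω + δ)` is rewritten as `a x(ω) + b (x(ω +
δ) - x(ω)) / δ` with `a = g₁ - g₂` and `b = -g₂ δ`. The difference quotient extends smoothly to `δ =
0`, so this is a Lipschitz image of six real parameters. The gains of a unit secant may blow up as
`δ → 0`, but `a` and `b` do not. Indeed `|g₂|² (1 - |H(δ)|²)` is at most the squared norm of the
secant, and `1 - |H(δ)|² ≥ κ δ²` on `[-π, π]` (`mul_sq_le_one_sub_windowPower`). There `κ` is `ζ`
times a constant depending on `D`: Jordan-type bounds for the cosine give it for `|δ| ≤ π / N`, and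
the side-lobe condition gives it beyond. The net therefore has size polynomial in `N`, `ζ⁻¹` and
`ε⁻¹`.

Conclusion: a union bound over the net costs a multiple of the logarithm in the sample bound, which
half of the exponent `ε² M / 4096` absorbs. The crude deterministic estimate `√(N/M) ‖A v‖ ≤ √N ‖v‖`
passes from the net to all unit secants, and it also settles `ε ≥ √N` outright. -/

/-! ### Norm concentration for a matrix of independent fourth roots of unity. -/

/-- The fourth roots of unity. -/
def fourthRoot : Fin 4 → ℂ := ![1, -1, I, -I]

/-- The uniform distribution on four labels. -/
noncomputable abbrev labelMeasure : Measure (Fin 4) := uniformOn Set.univ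

instance : IsProbabilityMeasure labelMeasure :=
  isProbabilityMeasure_uniformOn Set.finite_univ Set.univ_nonempty

theorem integral_labelMeasure (f : Fin 4 → ℝ) :
    ∫ x, f x ∂labelMeasure = (f 0 + f 1 + f 2 + f 3) / 4 := by
  rw [integral_fintype (.of_finite), Fin.sum_univ_four]
  have h : ∀ a : Fin 4, (uniformOn (Set.univ : Set (Fin 4))).real {a} = 1/4 := by
    intro a
    rw [Measure.real, uniformOn_univ]; simp
  simp only [h, smul_eq_mul]; ring

/-- The labels of one row of the random matrix. -/
noncomputable abbrev rowMeasure (N : ℕ) : Measure (Fin N → Fin 4) :=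
  Measure.pi fun _ => labelMeasure

/-- The labels of the random matrix. -/
noncomputable abbrev labelMatrixMeasure (M N : ℕ) : Measure (Fin M → Fin N → Fin 4) :=
  Measure.pi fun _ => rowMeasure N

/-- The product of a row of fourth roots of unity with a vector. -/
noncomputable def rowSum {N : ℕ} (y : Fin N → ℂ) (e : Fin N → Fin 4) : ℂ :=
  ∑ n, fourthRoot (e n) * y n

theorem rowSum_re {N : ℕ} (y : Fin N → ℂ) (e : Fin N → Fin 4) :
    (rowSum y e).re = ∑ n, (fourthRoot (e n) * y n).re := by
  simp [rowSum]

/-- The average factors as `cosh ((a + b) / 2) * cosh ((a - b) / 2)`, and `cosh x ≤ exp (x² / 2)`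
applies to each factor. This keeps the optimal constant, unlike bounding the two terms separately.
-/
theorem cosh_add_cosh_le (a b : ℝ) :
    (Real.cosh a + Real.cosh b) / 2 ≤ Real.exp ((a ^ 2 + b ^ 2) / 4) := by
  have h1 := Real.cosh_add ((a + b) / 2) ((a - b) / 2)
  have h2 := Real.cosh_sub ((a + b) / 2) ((a - b) / 2)
  have e1 : (a + b) / 2 + (a - b) / 2 = a := by ring
  have e2 : (a + b) / 2 - (a - b) / 2 = b := by ring
  rw [e1] at h1
  rw [e2] at h2
  have h3 : (Real.cosh a + Real.cosh b) / 2
      = Real.cosh ((a + b) / 2) * Real.cosh ((a - b) / 2) := by linarith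
  rw [h3]
  calc _ ≤ Real.exp (((a + b) / 2) ^ 2 / 2) * Real.exp (((a - b) / 2) ^ 2 / 2) := by
        gcongr
        · exact Real.cosh_le_exp_half_sq _
        · exact Real.cosh_le_exp_half_sq _
    _ = _ := by rw [← Real.exp_add]; congr 1; ring

/-- The variable is uniform on `±Re y, ±Im y`, so its moment generating function is an average of
two hyperbolic cosines. The variance proxy obtained equals the variance. -/
theorem hasSubgaussianMGF_fourthRoot_mul (y : ℂ) :
    HasSubgaussianMGF (fun k => (fourthRoot k * y).re) (‖y‖₊ ^ 2 / 2) labelMeasure where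
  integrable_exp_mul _ := .of_finite
  mgf_le t := by
    rw [mgf, integral_labelMeasure]
    have h := cosh_add_cosh_le (t * y.re) (t * y.im)
    have h2 : ‖y‖ ^ 2 = y.re ^ 2 + y.im ^ 2 := by rw [Complex.sq_norm, Complex.normSq_apply]; ring
    refine le_trans (le_of_eq ?_) (h.trans (le_of_eq ?_))
    · simp [fourthRoot, Real.cosh_eq]; ring
    · push_cast; rw [h2]; congr 1; ring

theorem hasSubgaussianMGF_rowSum_re {N : ℕ} (y : Fin N → ℂ) :
    HasSubgaussianMGF (fun e => (rowSum y e).re) (∑ n, ‖y n‖₊ ^ 2 / 2) (rowMeasure N) := by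
  have hi : iIndepFun (fun (n : Fin N) (e : Fin N → Fin 4) => (fourthRoot (e n) * y n).re)
      (rowMeasure N) :=
    iIndepFun_pi (X := fun n k => (fourthRoot k * y n).re) fun n => .of_discrete
  have h := HasSubgaussianMGF.sum_of_iIndepFun hi (s := Finset.univ)
    (c := fun n => ‖y n‖₊ ^ 2 / 2) ?_
  · simpa only [rowSum_re] using h
  · intro n _
    refine HasSubgaussianMGF.of_map (Y := fun e : Fin N → Fin 4 => e n)
      (X := fun k => (fourthRoot k * y n).re) (.of_discrete) ?_
    rw [(measurePreserving_eval (fun _ : Fin N => labelMeasure) n).map_eq]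
    exact hasSubgaussianMGF_fourthRoot_mul _

theorem integral_exp_neg_sq_add_mul (r : ℝ) :
    Integrable (fun g : ℝ => Real.exp (-g ^ 2 / 2 + g * r)) ∧
    ∫ g : ℝ, Real.exp (-g ^ 2 / 2 + g * r) = √(2 * Real.pi) * Real.exp (r ^ 2 / 2) := by
  have e : (fun g : ℝ => Real.exp (-g ^ 2 / 2 + g * r))
      = fun g => Real.exp (-(1 / 2) * (g - r) ^ 2) * Real.exp (r ^ 2 / 2) := by
    funext g; rw [← Real.exp_add]; congr 1; ring
  rw [e]
  refine ⟨((integrable_exp_neg_mul_sq (b := 1 / 2) (by norm_num)).comp_sub_right r).mul_const _, ?_⟩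
  rw [integral_mul_const, integral_sub_right_eq_self (fun g : ℝ => Real.exp (-(1 / 2) * g ^ 2)) r,
    integral_gaussian]
  congr 2; ring

/-- The square of a sub-Gaussian variable on a finite space has an exponential moment. -/
theorem HasSubgaussianMGF.integral_exp_half_sq_le {Ω : Type*} [MeasurableSpace Ω]
    [MeasurableSingletonClass Ω] [Fintype Ω] {Q : Measure Ω} [IsFiniteMeasure Q] {X : Ω → ℝ}
    {c : NNReal} (h : HasSubgaussianMGF X c Q) (hc : (c : ℝ) = 1 / 2) :
    ∫ e, Real.exp (X e ^ 2 / 2) ∂Q ≤ √2 := by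
  -- Gaussian linearization: `exp (X² / 2)` is the mean of `exp (g X)` over a standard Gaussian `g`.
  -- Exchanging the two means leaves the moment generating function of `X` at `g`, which is at most
  -- `exp (g² / 4)`.
  have h1 : √(2 * Real.pi) * ∫ e, Real.exp (X e ^ 2 / 2) ∂Q
      = ∫ g : ℝ, Real.exp (-g ^ 2 / 2) * mgf X Q g := by
    simp only [mgf]
    simp_rw [integral_fintype (μ := Q) (.of_finite), Finset.mul_sum]
    rw [integral_finsetSum]
    · refine Finset.sum_congr rfl fun e _ => ?_
      have := (integral_exp_neg_sq_add_mul (X e)).2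
      simp only [smul_eq_mul]
      rw [mul_left_comm, ← this, ← integral_const_mul]
      congr 1; funext g; rw [Real.exp_add]; ring
    · intro e _
      refine ((integral_exp_neg_sq_add_mul (X e)).1.const_mul (Q.real {e})).congr
        (Filter.Eventually.of_forall fun g => ?_)
      simp only [smul_eq_mul, Real.exp_add]; ring
  have h2 : ∫ g : ℝ, Real.exp (-g ^ 2 / 2) * mgf X Q g ≤ ∫ g : ℝ, Real.exp (-(1 / 4) * g ^ 2) := by
    refine integral_mono_of_nonneg (Filter.Eventually.of_forall fun g => ?_)
      (integrable_exp_neg_mul_sq (by norm_num)) (Filter.Eventually.of_forall fun g => ?_)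
    · exact mul_nonneg (Real.exp_pos _).le mgf_nonneg
    · calc _ ≤ Real.exp (-g ^ 2 / 2) * Real.exp (c * g ^ 2 / 2) :=
            mul_le_mul_of_nonneg_left (h.mgf_le g) (Real.exp_pos _).le
        _ = _ := by rw [← Real.exp_add, hc]; congr 1; ring
  rw [integral_gaussian] at h2
  have h3 : √(Real.pi / (1 / 4)) = √(2 * Real.pi) * √2 := by
    rw [← Real.sqrt_mul (by positivity)]; congr 1; ring
  rw [← h1, h3] at h2
  exact le_of_mul_le_mul_left h2 (by positivity)

theorem rowSum_I_mul {N : ℕ} (y : Fin N → ℂ) (e : Fin N → Fin 4) :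
    (rowSum (fun n => -I * y n) e).re = (rowSum y e).im := by
  have : rowSum (fun n => -I * y n) e = -I * rowSum y e := by
    simp only [rowSum, Finset.mul_sum]
    exact Finset.sum_congr rfl fun n _ => by ring
  rw [this]; simp

/-- The real and imaginary parts are dependent, so the exponential of their sum of squares is split
by the inequality of arithmetic and geometric means. Each half then has mean at most `√2`. -/
theorem integral_exp_norm_sq_rowSum_le {N : ℕ} (y : Fin N → ℂ) (hy : ∑ n, ‖y n‖ ^ 2 = 1) :
    ∫ e, Real.exp (‖rowSum y e‖ ^ 2 / 4) ∂rowMeasure N ≤ 2 := by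
  have hc : ∀ z : Fin N → ℂ, (∑ n, ‖z n‖ ^ 2 = 1) →
      ((∑ n, ‖z n‖₊ ^ 2 / 2 : NNReal) : ℝ) = 1 / 2 := by
    intro z hz; push_cast; rw [← Finset.sum_div, hz]
  have h1 := HasSubgaussianMGF.integral_exp_half_sq_le (hasSubgaussianMGF_rowSum_re y) (hc y hy)
  have h2 := HasSubgaussianMGF.integral_exp_half_sq_le
    (hasSubgaussianMGF_rowSum_re (fun n => -I * y n)) (hc _ (by simpa using hy))
  simp only [rowSum_I_mul] at h2
  calc ∫ e, Real.exp (‖rowSum y e‖ ^ 2 / 4) ∂rowMeasure N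
      ≤ ∫ e, (Real.exp ((rowSum y e).re ^ 2 / 2) + Real.exp ((rowSum y e).im ^ 2 / 2)) / 2
          ∂rowMeasure N := by
        refine integral_mono .of_finite .of_finite fun e => ?_
        have hz : ‖rowSum y e‖ ^ 2 = (rowSum y e).re ^ 2 + (rowSum y e).im ^ 2 := by
          rw [Complex.sq_norm, Complex.normSq_apply]; ring
        simp only [hz]
        set a := (rowSum y e).re ^ 2
        set b := (rowSum y e).im ^ 2
        have e1 : Real.exp ((a + b) / 4) = Real.exp (a / 4) * Real.exp (b / 4) := by
          rw [← Real.exp_add]; congr 1; ring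
        have e2 : Real.exp (a / 2) = Real.exp (a / 4) ^ 2 := by
          rw [← Real.exp_nat_mul]; congr 1; push_cast; ring
        have e3 : Real.exp (b / 2) = Real.exp (b / 4) ^ 2 := by
          rw [← Real.exp_nat_mul]; congr 1; push_cast; ring
        rw [e1, e2, e3]
        nlinarith [sq_nonneg (Real.exp (a / 4) - Real.exp (b / 4))]
    _ ≤ (√2 + √2) / 2 := by
        rw [integral_div, integral_add .of_finite .of_finite]
        gcongr
    _ ≤ 2 := by
        have : √2 ≤ 2 := Real.sqrt_le_iff.2 ⟨by norm_num, by norm_num⟩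
        linarith

theorem integral_fourthRoot_mul_re_sq (y : ℂ) :
    ∫ k, (fourthRoot k * y).re ^ 2 ∂labelMeasure = ‖y‖ ^ 2 / 2 := by
  rw [integral_labelMeasure, Complex.sq_norm, Complex.normSq_apply]
  simp [fourthRoot]; ring

theorem integral_fourthRoot_mul_re (y : ℂ) :
    ∫ k, (fourthRoot k * y).re ∂labelMeasure = 0 := by
  rw [integral_labelMeasure]
  simp [fourthRoot]

theorem memLp_of_finite {Ω : Type*} [MeasurableSpace Ω] [MeasurableSingletonClass Ω] [Finite Ω]
    {Q : Measure Ω} [IsFiniteMeasure Q] (f : Ω → ℝ) : MemLp f 2 Q := by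
  rw [memLp_two_iff_integrable_sq Integrable.of_finite.aestronglyMeasurable]
  exact .of_finite

theorem integral_rowSum_re_sq {N : ℕ} (y : Fin N → ℂ) :
    ∫ e, (rowSum y e).re ^ 2 ∂rowMeasure N = (∑ n, ‖y n‖ ^ 2) / 2 := by
  have h := variance_sum_pi (μ := fun _ : Fin N => labelMeasure)
    (X := fun n k => (fourthRoot k * y n).re) fun n => memLp_of_finite _
  have e : (∑ n, fun e : Fin N → Fin 4 => (fourthRoot (e n) * y n).re)
      = fun e => (rowSum y e).re := by
    funext e; rw [rowSum_re]; simp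
  have h0 : ∫ e, (rowSum y e).re ∂rowMeasure N = 0 := by
    simp only [rowSum_re]
    rw [integral_finsetSum _ fun n _ => .of_finite]
    refine Finset.sum_eq_zero fun n _ => ?_
    rw [integral_comp_eval (μ := fun _ : Fin N => labelMeasure) (i := n)
      (f := fun k => (fourthRoot k * y n).re) (Integrable.of_finite.aestronglyMeasurable),
      integral_fourthRoot_mul_re]
  rw [e, variance_of_integral_eq_zero (by exact .of_discrete) h0] at h
  rw [h, Finset.sum_div]
  refine Finset.sum_congr rfl fun n _ => ?_
  rw [variance_of_integral_eq_zero .of_discrete (integral_fourthRoot_mul_re _),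
    integral_fourthRoot_mul_re_sq]

theorem integral_norm_sq_rowSum {N : ℕ} (y : Fin N → ℂ) :
    ∫ e, ‖rowSum y e‖ ^ 2 ∂rowMeasure N = ∑ n, ‖y n‖ ^ 2 := by
  have h1 := integral_rowSum_re_sq y
  have h2 := integral_rowSum_re_sq (fun n => -I * y n)
  simp only [rowSum_I_mul] at h2
  have hz : ∀ e, ‖rowSum y e‖ ^ 2 = (rowSum y e).re ^ 2 + (rowSum y e).im ^ 2 := fun e => by
    rw [Complex.sq_norm, Complex.normSq_apply]; ring
  simp only [hz]
  rw [integral_add .of_finite .of_finite, h1, h2]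
  simp

theorem exp_le_one_add_add_sq_mul (u : ℝ) :
    Real.exp u ≤ 1 + u + u ^ 2 * Real.exp |u| := by
  have h := Complex.norm_exp_sub_sum_le_norm_mul_exp (u : ℂ) 2
  simp only [Finset.sum_range_succ, Finset.sum_range_zero] at h
  have e : Complex.exp (u : ℂ) - (0 + (u : ℂ) ^ 0 / (Nat.factorial 0 : ℕ) + (u : ℂ) ^ 1 / (Nat.factorial 1 : ℕ))
      = ((Real.exp u - (1 + u) : ℝ) : ℂ) := by
    push_cast; simp
  rw [e, Complex.norm_real, Complex.norm_real, Real.norm_eq_abs, Real.norm_eq_abs, sq_abs] at h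
  linarith [le_abs_self (Real.exp u - (1 + u))]

/-- Second-order expansion of the exponential: the linear term has mean exactly `t`, and the
exponential moment at `1 / 4` dominates the quadratic remainder. -/
theorem mgf_norm_sq_rowSum_le {N : ℕ} (y : Fin N → ℂ) (hy : ∑ n, ‖y n‖ ^ 2 = 1) {t : ℝ}
    (ht : |t| ≤ 1 / 8) :
    mgf (fun e => ‖rowSum y e‖ ^ 2) (rowMeasure N) t ≤ Real.exp (t + 256 * t ^ 2) := by
  have key : ∀ e, Real.exp (t * ‖rowSum y e‖ ^ 2)
      ≤ 1 + t * ‖rowSum y e‖ ^ 2 + 128 * t ^ 2 * Real.exp (‖rowSum y e‖ ^ 2 / 4) := by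
    intro e
    set Z := ‖rowSum y e‖ ^ 2 with hZ
    have hZ0 : 0 ≤ Z := by positivity
    have h1 := exp_le_one_add_add_sq_mul (t * Z)
    have h2 : |t * Z| ≤ Z / 8 := by
      rw [abs_mul, abs_of_nonneg hZ0]; nlinarith
    have h3 : Real.exp |t * Z| ≤ Real.exp (Z / 8) := Real.exp_le_exp.2 h2
    have h4 := Real.quadratic_le_exp_of_nonneg (x := Z / 8) (by positivity)
    have h5 : Real.exp (Z / 4) = Real.exp (Z / 8) * Real.exp (Z / 8) := by
      rw [← Real.exp_add]; congr 1; ring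
    -- This is `x² / 2 ≤ exp x` at `x = Z / 8`. One factor `exp (Z / 8)` pays for `Z²` and another
    -- for `exp |t Z|`, which together make `exp (Z / 4)`.
    have h6 : Z ^ 2 ≤ 128 * Real.exp (Z / 8) := by nlinarith
    have h7 : (t * Z) ^ 2 * Real.exp |t * Z| ≤ 128 * t ^ 2 * Real.exp (Z / 4) := by
      calc _ ≤ (t * Z) ^ 2 * Real.exp (Z / 8) := by gcongr
        _ = t ^ 2 * (Z ^ 2 * Real.exp (Z / 8)) := by ring
        _ ≤ t ^ 2 * (128 * Real.exp (Z / 8) * Real.exp (Z / 8)) := by gcongr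
        _ = _ := by rw [h5]; ring
    linarith
  calc mgf (fun e => ‖rowSum y e‖ ^ 2) (rowMeasure N) t
      ≤ ∫ e, (1 + t * ‖rowSum y e‖ ^ 2 + 128 * t ^ 2 * Real.exp (‖rowSum y e‖ ^ 2 / 4))
          ∂rowMeasure N := integral_mono .of_finite .of_finite key
    _ = 1 + t + 128 * t ^ 2 * ∫ e, Real.exp (‖rowSum y e‖ ^ 2 / 4) ∂rowMeasure N := by
        rw [integral_add .of_finite .of_finite, integral_add .of_finite .of_finite,
          integral_const_mul, integral_const_mul, integral_norm_sq_rowSum, hy]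
        simp
    _ ≤ 1 + t + 128 * t ^ 2 * 2 := by gcongr; exact integral_exp_norm_sq_rowSum_le y hy
    _ ≤ _ := by linarith [Real.add_one_le_exp (t + 256 * t ^ 2)]

/-- The squared norm of the product of a matrix of fourth roots of unity with a vector. -/
noncomputable def matrixEnergy {M N : ℕ} (y : Fin N → ℂ) (e : Fin M → Fin N → Fin 4) : ℝ :=
  ∑ m, ‖rowSum y (e m)‖ ^ 2

theorem mgf_matrixEnergy_le {M N : ℕ} (y : Fin N → ℂ) (hy : ∑ n, ‖y n‖ ^ 2 = 1) {t : ℝ}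
    (ht : |t| ≤ 1 / 8) :
    mgf (matrixEnergy (M := M) y) (labelMatrixMeasure M N) t
      ≤ Real.exp (M * (t + 256 * t ^ 2)) := by
  have hi : iIndepFun (fun (m : Fin M) (e : Fin M → Fin N → Fin 4) => ‖rowSum y (e m)‖ ^ 2)
      (labelMatrixMeasure M N) :=
    iIndepFun_pi (X := fun _ r => ‖rowSum y r‖ ^ 2) fun n => .of_discrete
  have h := hi.mgf_sum₀ (t := t) (fun m => .of_discrete) Finset.univ
  have e : (∑ m, fun e : Fin M → Fin N → Fin 4 => ‖rowSum y (e m)‖ ^ 2) = matrixEnergy y := by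
    funext e; simp [matrixEnergy]
  rw [e] at h
  rw [h]
  have hm : ∀ m : Fin M, mgf (fun e : Fin M → Fin N → Fin 4 => ‖rowSum y (e m)‖ ^ 2)
      (labelMatrixMeasure M N) t = mgf (fun r => ‖rowSum y r‖ ^ 2) (rowMeasure N) t := by
    intro m
    exact integral_comp_eval (μ := fun _ : Fin M => rowMeasure N) (i := m)
      (f := fun r => Real.exp (t * ‖rowSum y r‖ ^ 2)) (Integrable.of_finite.aestronglyMeasurable)
  simp only [hm]
  rw [Finset.prod_const, Finset.card_univ, Fintype.card_fin, Real.exp_nat_mul]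
  exact pow_le_pow_left₀ mgf_nonneg (mgf_norm_sq_rowSum_le y hy ht) M

theorem matrixEnergy_upper_tail {M N : ℕ} (y : Fin N → ℂ) (hy : ∑ n, ‖y n‖ ^ 2 = 1) {t : ℝ}
    (ht : 0 ≤ t) :
    (labelMatrixMeasure M N).real {e | M * (1 + t) ^ 2 ≤ matrixEnergy y e}
      ≤ Real.exp (-(1 / 1024 * t ^ 2 * M)) := by
  have main : ∀ l : ℝ, 0 ≤ l → l ≤ 1 / 8 → l + 256 * l ^ 2 - l * (1 + t) ^ 2 ≤ - (1 / 1024 * t ^ 2) →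
      (labelMatrixMeasure M N).real {e | M * (1 + t) ^ 2 ≤ matrixEnergy y e}
      ≤ Real.exp (-(1 / 1024 * t ^ 2 * M)) := by
    intro l hl hl' h
    refine (measure_ge_le_exp_mul_mgf _ hl .of_finite).trans ?_
    calc _ ≤ Real.exp (-l * (M * (1 + t) ^ 2)) * Real.exp (M * (l + 256 * l ^ 2)) := by
          gcongr
          exact mgf_matrixEnergy_le y hy (by rwa [abs_of_nonneg hl])
      _ = Real.exp (M * (l + 256 * l ^ 2 - l * (1 + t) ^ 2)) := by
          rw [← Real.exp_add]; congr 1; ring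
      _ ≤ Real.exp (M * (- (1 / 1024 * t ^ 2))) := by gcongr
      _ = _ := by congr 1; ring
  -- Chernoff parameter: `t / 512` minimizes `256 l² - 2 t l` up to a constant factor. For `t ≥ 1`
  -- it is frozen at `1 / 512` to stay within `l ≤ 1 / 8`, and the term `l t²` then supplies the
  -- decay.
  rcases le_total t 1 with h1 | h1
  · exact main (t / 512) (by positivity) (by linarith) (by nlinarith [pow_nonneg ht 3, sq_nonneg t])
  · exact main (1 / 512) (by positivity) (by norm_num) (by nlinarith)

theorem matrixEnergy_lower_tail {M N : ℕ} (y : Fin N → ℂ) (hy : ∑ n, ‖y n‖ ^ 2 = 1) {t : ℝ}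
    (ht : 0 ≤ t) (ht1 : t ≤ 1) :
    (labelMatrixMeasure M N).real {e | matrixEnergy y e ≤ M * (1 - t) ^ 2}
      ≤ Real.exp (-(1 / 1024 * t ^ 2 * M)) := by
  refine (measure_le_le_exp_mul_mgf (t := -(t / 512)) _ (by linarith) .of_finite).trans ?_
  calc _ ≤ Real.exp (-(-(t / 512)) * (M * (1 - t) ^ 2)) *
          Real.exp (M * (-(t / 512) + 256 * (-(t / 512)) ^ 2)) := by
        gcongr
        exact mgf_matrixEnergy_le y hy (by rw [abs_neg, abs_of_nonneg (by positivity)]; linarith)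
    _ = Real.exp (M * (-(t / 512) + 256 * (t / 512) ^ 2 + t / 512 * (1 - t) ^ 2)) := by
        rw [← Real.exp_add]; congr 1; ring
    _ ≤ Real.exp (M * (- (1 / 1024 * t ^ 2))) := by
        gcongr
        nlinarith [mul_nonneg (sq_nonneg t) (sub_nonneg.2 ht1)]
    _ = _ := by congr 1; ring

/-- Norm concentration for a fixed unit vector. -/
theorem matrixEnergy_tail {M N : ℕ} (y : Fin N → ℂ) (hy : ∑ n, ‖y n‖ ^ 2 = 1) {t : ℝ}
    (ht : 0 ≤ t) :
    (labelMatrixMeasure M N).real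
        {e | ¬ ((1 - t) * √M ≤ √(matrixEnergy y e) ∧ √(matrixEnergy y e) ≤ (1 + t) * √M)}
      ≤ 2 * Real.exp (-(1 / 1024 * t ^ 2 * M)) := by
  have hE : ∀ e, 0 ≤ matrixEnergy (M := M) y e := fun e =>
    Finset.sum_nonneg fun m _ => by positivity
  have hup : ∀ e : Fin M → Fin N → Fin 4, (1 + t) * √M < √(matrixEnergy y e) →
      M * (1 + t) ^ 2 ≤ matrixEnergy y e := by
    intro e h
    have := (Real.lt_sqrt (by positivity)).1 h
    rw [mul_pow, Real.sq_sqrt (by positivity)] at this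
    linarith
  rcases le_total t 1 with h1 | h1
  · calc _ ≤ (labelMatrixMeasure M N).real ({e | matrixEnergy y e ≤ M * (1 - t) ^ 2} ∪
          {e | M * (1 + t) ^ 2 ≤ matrixEnergy y e}) := by
          refine measureReal_mono fun e he => ?_
          simp only [Set.mem_ofPred_eq, not_and_or, not_le] at he
          rcases he with he | he
          · left
            have h0 := Real.sqrt_nonneg (matrixEnergy y e)
            have := pow_le_pow_left₀ h0 he.le 2
            rw [mul_pow, Real.sq_sqrt (Nat.cast_nonneg M), Real.sq_sqrt (hE e)] at this
            simp only [Set.mem_ofPred_eq]; linarith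
          · exact Or.inr (hup e he)
      _ ≤ _ := measureReal_union_le _ _
      _ ≤ Real.exp (-(1 / 1024 * t ^ 2 * M)) + Real.exp (-(1 / 1024 * t ^ 2 * M)) :=
          add_le_add (matrixEnergy_lower_tail y hy ht h1) (matrixEnergy_upper_tail y hy ht)
      _ = _ := by ring
  -- For `t ≥ 1` the lower bound `(1 - t) √M` is nonpositive, so only the upper tail can fail.
  · calc _ ≤ (labelMatrixMeasure M N).real {e | M * (1 + t) ^ 2 ≤ matrixEnergy y e} := by
          refine measureReal_mono fun e he => ?_
          simp only [Set.mem_ofPred_eq, not_and_or, not_le] at he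
          rcases he with he | he
          · have h0 := Real.sqrt_nonneg (matrixEnergy y e)
            have := mul_nonpos_of_nonpos_of_nonneg (sub_nonpos.2 h1) (Real.sqrt_nonneg (M : ℝ))
            linarith
          · exact hup e he
      _ ≤ Real.exp (-(1 / 1024 * t ^ 2 * M)) := matrixEnergy_upper_tail y hy ht
      _ ≤ _ := by linarith [Real.exp_pos (-(1 / 1024 * t ^ 2 * M))]

/-! ### Transfer from the canonical label model to an arbitrary random phase matrix. -/

/-- The matrix with entries in `phaseAlphabet N` described by an array of labels. -/
noncomputable def labelMatrix {M N : ℕ} (e : Fin M → Fin N → Fin 4) : Matrix (Fin M) (Fin N) ℂ :=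
  fun m n => fourthRoot (e m n) * ((1 / √(N : ℝ) : ℝ) : ℂ)

theorem fourthRoot_injective : Function.Injective fourthRoot := by
  intro a b h
  fin_cases a <;> fin_cases b <;> simp [fourthRoot, Complex.ext_iff] at h ⊢ <;> norm_num at h

/-- For `N > 0` the labels map bijectively onto the alphabet, so normalized counting measure is
carried to normalized counting measure. -/
theorem map_labelMeasure {N : ℕ} (hN : 0 < N) :
    labelMeasure.map (fun k => fourthRoot k * ((1 / √(N : ℝ) : ℝ) : ℂ))
      = uniformOn (phaseAlphabet N) := by
  have hs : 0 < 1 / √(N : ℝ) := by positivity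
  have hinj : Function.Injective fun k => fourthRoot k * ((1 / √(N : ℝ) : ℝ) : ℂ) := by
    intro a b h
    exact fourthRoot_injective (mul_right_cancel₀ (by exact_mod_cast hs.ne') h)
  have himg : (fun k => fourthRoot k * ((1 / √(N : ℝ) : ℝ) : ℂ)) '' Set.univ
      = phaseAlphabet N := by
    ext z
    simp only [Set.image_univ, Set.mem_range, phaseAlphabet, Set.mem_insert_iff,
      Set.mem_singleton_iff, Fin.exists_fin_succ]
    simp [fourthRoot, eq_comm]
  ext t ht
  have hm : MeasurableSet (phaseAlphabet N) := by
    rw [← himg]; exact (Set.toFinite _).measurableSet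
  rw [Measure.map_apply .of_discrete ht]
  change (Measure.count[|Set.univ]) _ = (Measure.count[|phaseAlphabet N]) _
  rw [cond_apply .univ, cond_apply hm,
    ← himg, ← Set.image_inter_preimage, Measure.count_injective_image hinj,
    Measure.count_injective_image hinj]

theorem map_curry_pi {ι κ α : Type*} [Fintype ι] [Fintype κ] [MeasurableSpace α]
    (μ : Measure α) [IsProbabilityMeasure μ] :
    (Measure.pi fun _ : ι × κ => μ).map (fun x i j => x (i, j))
      = Measure.pi fun _ : ι => Measure.pi fun _ : κ => μ := by
  have h : Measure.pi (fun _ : ι × κ => μ)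
      = (Measure.pi fun _ : ι => Measure.pi fun _ : κ => μ).map (fun x p => x p.1 p.2) := by
    refine Measure.pi_eq fun s hs => ?_
    rw [Measure.map_apply (by fun_prop) (MeasurableSet.univ_pi hs)]
    have : (fun (x : ι → κ → α) (p : ι × κ) => x p.1 p.2) ⁻¹' Set.univ.pi s
        = Set.univ.pi fun i => Set.univ.pi fun j => s (i, j) := by
      ext x; simp [Prod.forall]
    rw [this, Measure.pi_pi]
    simp_rw [Measure.pi_pi]
    rw [Fintype.prod_prod_type]
  rw [h, Measure.map_map (by fun_prop) (by fun_prop)]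
  exact Measure.map_id

theorem IsRandomPhaseMatrix.map_eq {Ω : Type*} [MeasurableSpace Ω] {P : Measure Ω}
    [IsProbabilityMeasure P] {M N : ℕ} (hN : 0 < N) {A : Ω → Matrix (Fin M) (Fin N) ℂ}
    (hA : IsRandomPhaseMatrix P A) :
    P.map (fun s (m : Fin M) (n : Fin N) => A s m n)
      = (labelMatrixMeasure M N).map fun e m n => labelMatrix e m n := by
  have hm : ∀ p : Fin M × Fin N, AEMeasurable (fun s => A s p.1 p.2) P := fun p =>
    (hA.hasLaw p.1 p.2).aemeasurable
  have h1 := hA.indep.map_fun_eq_pi_map hm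
  simp only [(hA.hasLaw _ _).map_eq] at h1
  have hp : IsProbabilityMeasure (uniformOn (phaseAlphabet N)) := by
    rw [← map_labelMeasure hN]
    exact Measure.isProbabilityMeasure_map .of_discrete
  have h2 : P.map (fun s (m : Fin M) (n : Fin N) => A s m n)
      = (P.map fun s (p : Fin M × Fin N) => A s p.1 p.2).map (fun x i j => x (i, j)) := by
    rw [AEMeasurable.map_map_of_aemeasurable (Measurable.aemeasurable (by fun_prop)) (aemeasurable_pi_iff.2 hm)]
    rfl
  rw [h2, h1, map_curry_pi]
  have h3 : Measure.pi (fun _ : Fin N => uniformOn (phaseAlphabet N))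
      = (rowMeasure N).map fun r n => fourthRoot (r n) * ((1 / √(N : ℝ) : ℝ) : ℂ) := by
    have := fun _ : Fin N => Measure.isProbabilityMeasure_map (μ := labelMeasure)
      (f := fun k => fourthRoot k * ((1 / √(N : ℝ) : ℝ) : ℂ)) .of_discrete
    rw [Measure.pi_map_pi (μ := fun _ : Fin N => labelMeasure)
      (f := fun _ k => fourthRoot k * ((1 / √(N : ℝ) : ℝ) : ℂ)) fun _ => .of_discrete]
    simp only [map_labelMeasure hN]
  have := fun _ : Fin M => Measure.isProbabilityMeasure_map (μ := rowMeasure N)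
    (f := fun r n => fourthRoot (r n) * ((1 / √(N : ℝ) : ℝ) : ℂ)) .of_discrete
  simp only [h3]
  rw [← Measure.pi_map_pi (μ := fun _ : Fin M => rowMeasure N)
    (f := fun _ r n => fourthRoot (r n) * ((1 / √(N : ℝ) : ℝ) : ℂ)) fun _ => .of_discrete]
  rfl

/-- Events about a random phase matrix are at least as likely as the corresponding events about
the canonical model, without measurability assumptions. -/
theorem IsRandomPhaseMatrix.le_measureReal {Ω : Type*} [MeasurableSpace Ω] {P : Measure Ω}
    [IsProbabilityMeasure P] {M N : ℕ} (hN : 0 < N) {A : Ω → Matrix (Fin M) (Fin N) ℂ}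
    (hA : IsRandomPhaseMatrix P A) (S : Set (Matrix (Fin M) (Fin N) ℂ)) :
    (labelMatrixMeasure M N).real {e | labelMatrix e ∈ S} ≤ P.real {s | A s ∈ S} := by
  have hmA : AEMeasurable (fun s (m : Fin M) (n : Fin N) => A s m n) P :=
    aemeasurable_pi_iff.2 fun m => aemeasurable_pi_iff.2 fun n => (hA.hasLaw m n).aemeasurable
  -- Only the finitely many label matrices in `S` matter. Their set is finite, hence measurable,
  -- even when `S` is not known to be.
  set T : Set (Fin M → Fin N → ℂ) := (fun e m n => labelMatrix e m n) '' {e | labelMatrix e ∈ S}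
    with hT
  have hTm : MeasurableSet T := (Set.toFinite _).measurableSet
  calc (labelMatrixMeasure M N).real {e | labelMatrix e ∈ S}
      ≤ (labelMatrixMeasure M N).real ((fun e m n => labelMatrix e m n) ⁻¹' T) :=
        measureReal_mono (Set.subset_preimage_image _ _)
    _ = P.real ((fun s (m : Fin M) (n : Fin N) => A s m n) ⁻¹' T) := by
        rw [← map_measureReal_apply .of_discrete hTm, ← hA.map_eq hN,
          map_measureReal_apply_of_aemeasurable hmA hTm]
    _ ≤ _ := by
        refine measureReal_mono ?_
        rintro s ⟨e, he, h⟩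
        have : labelMatrix e = A s := h
        rw [Set.mem_ofPred_eq, ← this]
        exact he

/-! ### Quadratic separation of `|H|²` from its peak. -/

section WindowPower

variable {N : ℕ}

/-- `∑ᵢₖ |hᵢ|² |hₖ|² (pᵢ - pₖ)²`, twice the variance of the position. -/
noncomputable def windowSpread (h : Fin N → ℂ) : ℝ :=
  ∑ i, ∑ k, ‖h i‖ ^ 2 * ‖h k‖ ^ 2 * (centredPos N i - centredPos N k) ^ 2

theorem centredPos_sub (i k : Fin N) :
    centredPos N i - centredPos N k = (((i : ℕ) : ℤ) - ((k : ℕ) : ℤ) : ℤ) := by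
  simp [centredPos]

theorem abs_centredPos_sub_le (i k : Fin N) : |centredPos N i - centredPos N k| ≤ N := by
  have hi : ((i : ℕ) : ℝ) < N := by exact_mod_cast i.2
  have hk : ((k : ℕ) : ℝ) < N := by exact_mod_cast k.2
  have hi0 : (0 : ℝ) ≤ ((i : ℕ) : ℝ) := by positivity
  have hk0 : (0 : ℝ) ≤ ((k : ℕ) : ℝ) := by positivity
  rw [abs_le]; simp only [centredPos]; constructor <;> linarith

theorem abs_centredPos_le (i : Fin N) : |centredPos N i| ≤ N / 2 := by
  have hi : ((i : ℕ) : ℝ) + 1 ≤ N := by exact_mod_cast i.2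
  have hi0 : (0 : ℝ) ≤ ((i : ℕ) : ℝ) := by positivity
  rw [abs_le]; simp only [centredPos]; constructor <;> linarith

theorem windowPower_eq_sum (h : Fin N → ℂ) (ω : ℝ) :
    windowPower h ω = ∑ i, ∑ k, ‖h i‖ ^ 2 * ‖h k‖ ^ 2 *
      Real.cos (ω * (centredPos N i - centredPos N k)) := by
  have e : ∀ i : Fin N, I * (ω : ℂ) * (centredPos N i : ℂ) = ((ω * centredPos N i : ℝ) : ℂ) * I := by
    intro i; push_cast; ring
  have hre : (windowSpectrum h ω).re = ∑ i, ‖h i‖ ^ 2 * Real.cos (ω * centredPos N i) := by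
    simp only [windowSpectrum, re_sum, re_ofReal_mul, e, exp_ofReal_mul_I_re]
  have him : (windowSpectrum h ω).im = ∑ i, ‖h i‖ ^ 2 * Real.sin (ω * centredPos N i) := by
    simp only [windowSpectrum, im_sum, im_ofReal_mul, e, exp_ofReal_mul_I_im]
  rw [windowPower, Complex.sq_norm, Complex.normSq_apply, hre, him, Finset.sum_mul_sum,
    Finset.sum_mul_sum, ← Finset.sum_add_distrib]
  refine Finset.sum_congr rfl fun i _ => ?_
  rw [← Finset.sum_add_distrib]
  refine Finset.sum_congr rfl fun k _ => ?_
  rw [mul_sub, Real.cos_sub]; ring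

theorem one_sub_windowPower {h : Fin N → ℂ} (hh : ∑ i, ‖h i‖ ^ 2 = 1) (ω : ℝ) :
    1 - windowPower h ω = ∑ i, ∑ k, ‖h i‖ ^ 2 * ‖h k‖ ^ 2 *
      (1 - Real.cos (ω * (centredPos N i - centredPos N k))) := by
  have h1 : (1 : ℝ) = ∑ i, ∑ k, ‖h i‖ ^ 2 * ‖h k‖ ^ 2 := by
    rw [← Finset.sum_mul_sum, hh, one_mul]
  rw [windowPower_eq_sum]
  conv_lhs => rw [h1]
  simp only [← Finset.sum_sub_distrib, mul_sub, mul_one]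

theorem windowPower_le_one {h : Fin N → ℂ} (hh : ∑ i, ‖h i‖ ^ 2 = 1) (ω : ℝ) :
    windowPower h ω ≤ 1 := by
  rw [← sub_nonneg, one_sub_windowPower hh]
  exact Finset.sum_nonneg fun i _ => Finset.sum_nonneg fun k _ =>
    mul_nonneg (by positivity) (sub_nonneg.2 (Real.cos_le_one _))

theorem windowPower_neg (h : Fin N → ℂ) (ω : ℝ) : windowPower h (-ω) = windowPower h ω := by
  simp only [windowPower_eq_sum, neg_mul, Real.cos_neg]

theorem windowPower_two_pi_sub (h : Fin N → ℂ) (ω : ℝ) :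
    windowPower h (2 * Real.pi - ω) = windowPower h ω := by
  simp only [windowPower_eq_sum]
  refine Finset.sum_congr rfl fun i _ => Finset.sum_congr rfl fun k _ => ?_
  rw [centredPos_sub, sub_mul, mul_comm (2 * Real.pi), Real.cos_int_mul_two_pi_sub]

theorem continuous_windowPower (h : Fin N → ℂ) : Continuous (windowPower h) := by
  rw [funext (windowPower_eq_sum h)]
  fun_prop

theorem windowSpread_nonneg (h : Fin N → ℂ) : 0 ≤ windowSpread h :=
  Finset.sum_nonneg fun _ _ => Finset.sum_nonneg fun _ _ => by positivity

theorem one_sub_windowPower_le {h : Fin N → ℂ} (hh : ∑ i, ‖h i‖ ^ 2 = 1) (ω : ℝ) :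
    1 - windowPower h ω ≤ ω ^ 2 / 2 * windowSpread h := by
  rw [one_sub_windowPower hh, windowSpread]
  simp only [Finset.mul_sum]
  refine Finset.sum_le_sum fun i _ => Finset.sum_le_sum fun k _ => ?_
  have := Real.one_sub_sq_div_two_le_cos (x := ω * (centredPos N i - centredPos N k))
  calc _ ≤ ‖h i‖ ^ 2 * ‖h k‖ ^ 2 * ((ω * (centredPos N i - centredPos N k)) ^ 2 / 2) := by
        gcongr; linarith
    _ = _ := by ring

/-- Position differences are at most `N`, so all angles lie in `[-π, π]`, where `1 - cos x ≥ 2 x² /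
π²`. The terms are then compared one by one. -/
theorem le_one_sub_windowPower {h : Fin N → ℂ} (hh : ∑ i, ‖h i‖ ^ 2 = 1) {ω : ℝ}
    (hω : |ω| * N ≤ Real.pi) :
    2 / Real.pi ^ 2 * ω ^ 2 * windowSpread h ≤ 1 - windowPower h ω := by
  rw [one_sub_windowPower hh, windowSpread]
  simp only [Finset.mul_sum]
  refine Finset.sum_le_sum fun i _ => Finset.sum_le_sum fun k _ => ?_
  have hx : |ω * (centredPos N i - centredPos N k)| ≤ Real.pi := by
    rw [abs_mul]
    exact (mul_le_mul_of_nonneg_left (abs_centredPos_sub_le i k) (abs_nonneg ω)).trans hω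
  have := Real.cos_le_one_sub_mul_cos_sq hx
  calc _ = ‖h i‖ ^ 2 * ‖h k‖ ^ 2 *
        (2 / Real.pi ^ 2 * (ω * (centredPos N i - centredPos N k)) ^ 2) := by ring
    _ ≤ _ := by gcongr; linarith

/-- A window concentrated at one position has `|H|² = 1` everywhere. Then `π` is a local maximum of
height `1 > D`, which the side-lobe condition excludes. -/
theorem windowSpread_pos {h : Fin N → ℂ} (hh : ∑ i, ‖h i‖ ^ 2 = 1) {D : ℝ} (hD : D < 1)
    (hS : SidelobesBelow h D) : 0 < windowSpread h := by
  rcases (windowSpread_nonneg h).lt_or_eq with h0 | h0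
  · exact h0
  exfalso
  have h1 : ∀ ω, windowPower h ω = 1 := fun ω => by
    have := one_sub_windowPower_le hh ω
    rw [← h0] at this
    exact le_antisymm (windowPower_le_one hh ω) (by linarith)
  have h2 := hS Real.pi (fun k hk => ?_) (Filter.Eventually.of_forall fun ω => by rw [h1, h1])
  · rw [h1] at h2; linarith
  · have h3 : (1 : ℝ) = 2 * k := mul_left_cancel₀ Real.pi_ne_zero (by linarith)
    have h4 : (1 : ℤ) = 2 * k := by exact_mod_cast h3
    omega

theorem iteratedDeriv_two_windowPower (h : Fin N → ℂ) :
    iteratedDeriv 2 (windowPower h) 0 = -windowSpread h := by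
  have h1 : ∀ ω, HasDerivAt (windowPower h) (∑ i, ∑ k, ‖h i‖ ^ 2 * ‖h k‖ ^ 2 *
      (-Real.sin (ω * (centredPos N i - centredPos N k)) * (centredPos N i - centredPos N k)))
      ω := by
    intro ω
    rw [funext (windowPower_eq_sum h)]
    refine HasDerivAt.fun_sum fun i _ => HasDerivAt.fun_sum fun k _ => HasDerivAt.const_mul _ ?_
    exact (hasDerivAt_mul_const (centredPos N i - centredPos N k)).cos
  have h2 : HasDerivAt (deriv (windowPower h)) (-windowSpread h) 0 := by
    rw [funext fun ω => (h1 ω).deriv, windowSpread, ← Finset.sum_neg_distrib]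
    refine HasDerivAt.fun_sum fun i _ => ?_
    rw [← Finset.sum_neg_distrib]
    refine HasDerivAt.fun_sum fun k _ => ?_
    have := ((((hasDerivAt_mul_const (x := (0 : ℝ))
      (centredPos N i - centredPos N k)).sin).neg).mul_const
      (centredPos N i - centredPos N k)).const_mul (‖h i‖ ^ 2 * ‖h k‖ ^ 2)
    convert! this using 1
    simp; ring
  rw [iteratedDeriv_succ, iteratedDeriv_one, h2.deriv]

theorem windowZeta_eq (h : Fin N → ℂ) : windowZeta h = windowSpread h / (2 * N ^ 2) := by
  rw [windowZeta, iteratedDeriv_two_windowPower]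
  rw [← div_div, div_eq_mul_inv _ ((N : ℝ) ^ 2)]; ring

theorem windowPower_le_of_sidelobesBelow {h : Fin N → ℂ} (hN : 0 < N) (hh : ∑ i, ‖h i‖ ^ 2 = 1)
    {D : ℝ} (hS : SidelobesBelow h D) {ω : ℝ} (h1 : Real.pi / N ≤ ω) (h2 : ω ≤ Real.pi) :
    windowPower h ω ≤ max D (1 - 4 * windowZeta h) := by
  have hN' : (0 : ℝ) < N := by exact_mod_cast hN
  have hpi := Real.pi_pos
  have ha : 0 < Real.pi / N := by positivity
  have hend : windowPower h (Real.pi / N) ≤ 1 - 4 * windowZeta h := by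
    have := le_one_sub_windowPower hh (ω := Real.pi / N)
      (by rw [abs_of_pos ha, div_mul_cancel₀ _ hN'.ne'])
    have e : 2 / Real.pi ^ 2 * (Real.pi / N) ^ 2 * windowSpread h = 4 * windowZeta h := by
      rw [windowZeta_eq]; field_simp; ring
    linarith
  -- The interval is symmetric about `π`, so both ends carry the same value, already bounded by `1 -
  -- 4 ζ`. A maximum in the interior is a local maximum away from `2πℤ`, hence below `D`.
  obtain ⟨m, hm, hmax⟩ := (isCompact_Icc (a := Real.pi / N) (b := 2 * Real.pi - Real.pi / N)
    ).exists_isMaxOn ⟨ω, h1, by linarith⟩ (continuous_windowPower h).continuousOn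
  refine (hmax ⟨h1, by linarith⟩ : windowPower h ω ≤ windowPower h m).trans ?_
  rcases hm.1.lt_or_eq with ha' | ha'
  · rcases hm.2.lt_or_eq with hb' | hb'
    · refine le_max_of_le_left (hS m (fun k hk => ?_) (hmax.isLocalMax (Icc_mem_nhds ha' hb'))).le
      have hk1 : (0 : ℝ) < k := by
        by_contra! hc
        have : 2 * Real.pi * k ≤ 0 := mul_nonpos_of_nonneg_of_nonpos (by positivity) hc
        linarith
      have hk2 : (1 : ℝ) ≤ k := by
        have : 0 < k := by exact_mod_cast hk1
        exact_mod_cast this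
      nlinarith
    · rw [hb', windowPower_two_pi_sub]
      exact le_max_of_le_right hend
  · rw [← ha']
    exact le_max_of_le_right hend

/-- Quadratic separation of the window power from its peak. -/
theorem mul_sq_le_one_sub_windowPower {h : Fin N → ℂ} (hN : 0 < N) (hh : ∑ i, ‖h i‖ ^ 2 = 1)
    {D : ℝ} (hS : SidelobesBelow h D) (hz : 0 ≤ windowZeta h) (hz1 : windowZeta h ≤ 1)
    (hD : D < 1) {ω : ℝ} (hω : |ω| ≤ Real.pi) :
    min (1 - D) 1 * windowZeta h / Real.pi ^ 2 * ω ^ 2 ≤ 1 - windowPower h ω := by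
  have hN' : (1 : ℝ) ≤ N := by exact_mod_cast hN
  have hd0 : 0 ≤ min (1 - D) 1 := le_min (by linarith) zero_le_one
  have hd1 : min (1 - D) 1 ≤ 1 := min_le_right _ _
  have hpi := Real.pi_pos
  rcases le_total (|ω| * N) Real.pi with hs | hs
  · refine le_trans ?_ (le_one_sub_windowPower hh hs)
    have e : windowSpread h = windowZeta h * (2 * N ^ 2) := by
      rw [windowZeta_eq]; field_simp
    rw [e]
    have : min (1 - D) 1 ≤ 4 * (N : ℝ) ^ 2 := by nlinarith
    calc _ = min (1 - D) 1 * (windowZeta h / Real.pi ^ 2 * ω ^ 2) := by ring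
      _ ≤ 4 * (N : ℝ) ^ 2 * (windowZeta h / Real.pi ^ 2 * ω ^ 2) := by gcongr
      _ = _ := by ring
  · have habs : windowPower h ω = windowPower h |ω| := by
      rcases abs_choice ω with hc | hc
      · rw [hc]
      · rw [hc, windowPower_neg]
    have hb := windowPower_le_of_sidelobesBelow hN hh hS (ω := |ω|)
      ((div_le_iff₀ (by linarith)).2 hs) hω
    rw [← habs] at hb
    have hsq : ω ^ 2 ≤ Real.pi ^ 2 := by
      rw [← sq_abs]; gcongr
    have h1 : min (1 - D) 1 * windowZeta h / Real.pi ^ 2 * ω ^ 2 ≤ min (1 - D) 1 * windowZeta h := by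
      rw [div_mul_eq_mul_div, div_le_iff₀ (by positivity)]
      gcongr
    refine h1.trans ?_
    rcases le_max_iff.1 hb with hb | hb
    · have : min (1 - D) 1 * windowZeta h ≤ (1 - D) * 1 :=
        mul_le_mul (min_le_left _ _) hz1 hz (by linarith)
      linarith
    · have : min (1 - D) 1 * windowZeta h ≤ 1 * windowZeta h := by gcongr
      linarith

end WindowPower

/-! ### The window parameters as moments of the position, and the argument of the logarithm. -/

section Parameters

variable {N : ℕ}

theorem norm_deriv_windowedSinusoid_sq (h : Fin N → ℂ) :
    ‖deriv (windowedSinusoid h) 0‖ ^ 2 = ∑ i, ‖h i‖ ^ 2 * centredPos N i ^ 2 := by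
  rw [(hasDerivAt_windowedSinusoid h 0).deriv, EuclideanSpace.norm_sq_eq]
  refine Finset.sum_congr rfl fun i _ => ?_
  simp [mul_pow]

theorem windowChi_eq (h : Fin N → ℂ) : windowChi h = |∑ i, ‖h i‖ ^ 2 * centredPos N i| := by
  have hd : HasDerivAt (windowSpectrum h)
      (∑ i, ((‖h i‖ ^ 2 : ℝ) : ℂ) * (I * (centredPos N i : ℂ))) 0 := by
    refine HasDerivAt.fun_sum fun i _ => HasDerivAt.const_mul _ ?_
    have h1 : HasDerivAt (fun t : ℝ => I * (t : ℂ) * (centredPos N i : ℂ))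
        (I * (centredPos N i : ℂ)) 0 := by
      simpa using (((hasDerivAt_id (0 : ℝ)).ofReal_comp).const_mul I).mul_const
        (centredPos N i : ℂ)
    simpa using h1.cexp
  rw [windowChi, hd.deriv]
  have e : ∑ i, ((‖h i‖ ^ 2 : ℝ) : ℂ) * (I * (centredPos N i : ℂ))
      = I * ((∑ i, ‖h i‖ ^ 2 * centredPos N i : ℝ) : ℂ) := by
    push_cast; rw [Finset.mul_sum]; exact Finset.sum_congr rfl fun i _ => by ring
  rw [e, norm_mul, norm_I, one_mul, norm_real, Real.norm_eq_abs]

/-- With `|hᵢ|²` as probabilities, `1 / τ²` is the second moment of the position and `χ` the modulus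
of its mean, so this is the variance identity. -/
theorem windowSpread_eq {h : Fin N → ℂ} (hh : ∑ i, ‖h i‖ ^ 2 = 1) :
    windowSpread h = 2 * (‖deriv (windowedSinusoid h) 0‖ ^ 2 - windowChi h ^ 2) := by
  rw [norm_deriv_windowedSinusoid_sq, windowChi_eq, sq_abs]
  have e : ∀ i k : Fin N, ‖h i‖ ^ 2 * ‖h k‖ ^ 2 * (centredPos N i - centredPos N k) ^ 2
      = (‖h i‖ ^ 2 * centredPos N i ^ 2) * ‖h k‖ ^ 2 + ‖h i‖ ^ 2 * (‖h k‖ ^ 2 * centredPos N k ^ 2)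
        - 2 * ((‖h i‖ ^ 2 * centredPos N i) * (‖h k‖ ^ 2 * centredPos N k)) := by
    intro i k; ring
  simp only [windowSpread, e, Finset.sum_sub_distrib, Finset.sum_add_distrib, ← Finset.mul_sum,
    ← Finset.sum_mul, hh]
  ring

theorem norm_deriv_windowedSinusoid_le {h : Fin N → ℂ} (hh : ∑ i, ‖h i‖ ^ 2 = 1) :
    ‖deriv (windowedSinusoid h) 0‖ ≤ N / 2 := by
  refine le_of_sq_le_sq ?_ (by positivity)
  rw [norm_deriv_windowedSinusoid_sq]
  calc _ ≤ ∑ i, ‖h i‖ ^ 2 * ((N : ℝ) / 2) ^ 2 := by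
        refine Finset.sum_le_sum fun i _ => mul_le_mul_of_nonneg_left ?_ (by positivity)
        exact sq_le_sq' (abs_le.1 (abs_centredPos_le i)).1 (abs_le.1 (abs_centredPos_le i)).2
    _ = _ := by rw [← Finset.sum_mul, hh, one_mul]

theorem windowZeta_le {h : Fin N → ℂ} (hN : 0 < N) (hh : ∑ i, ‖h i‖ ^ 2 = 1) :
    windowZeta h ≤ 1 / 4 := by
  have hN' : (0 : ℝ) < N := by exact_mod_cast hN
  rw [windowZeta_eq, windowSpread_eq hh, div_le_iff₀ (by positivity)]
  have := norm_deriv_windowedSinusoid_le hh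
  nlinarith [norm_nonneg (deriv (windowedSinusoid h) 0), sq_nonneg (windowChi h)]

/-- The argument of the logarithm in the sample bound dominates `2 N / (ε ζ)`. -/
theorem le_log_argument {h : Fin N → ℂ} (hN : 0 < N) (hh : ∑ i, ‖h i‖ ^ 2 = 1)
    (hW : 0 < windowSpread h) {ε : ℝ} (hε : 0 < ε) :
    (N : ℝ) * ε⁻¹ * (windowZeta h)⁻¹ * 2 ≤ (N : ℝ) * ε⁻¹ * (1 - windowTau h * windowChi h)⁻¹ *
      (windowZeta h)⁻¹ * (windowAlpha h)⁻¹ := by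
  have hN' : (0 : ℝ) < N := by exact_mod_cast hN
  have hz : 0 < windowZeta h := by rw [windowZeta_eq]; positivity
  have hs := windowSpread_eq hh
  have hc0 : 0 ≤ windowChi h := norm_nonneg _
  have hle := norm_deriv_windowedSinusoid_le hh
  have ht : windowTau h = 1 / ‖deriv (windowedSinusoid h) 0‖ := rfl
  have hα : windowAlpha h = ‖deriv (windowedSinusoid h) 0‖ / N := by
    rw [windowAlpha, ht]; field_simp
  set σ := ‖deriv (windowedSinusoid h) 0‖ with hσ
  have hσ0 : 0 ≤ σ := norm_nonneg _
  -- Positive variance makes `τ χ < 1`, so `(1 - τ χ)⁻¹ ≥ 1`. Since `α = σ / N ≤ 1 / 2`, the last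
  -- factor is at least `2`.
  have hlt : windowChi h < σ := by
    refine lt_of_pow_lt_pow_left₀ 2 hσ0 ?_
    linarith
  have hσ1 : 0 < σ := hc0.trans_lt hlt
  have h1 : 1 ≤ (1 - windowTau h * windowChi h)⁻¹ := by
    rw [ht, one_div, inv_mul_eq_div]
    have : windowChi h / σ < 1 := (div_lt_one hσ1).2 hlt
    have h0 : 0 ≤ windowChi h / σ := by positivity
    exact (one_le_inv₀ (by linarith)).2 (by linarith)
  have h2 : 2 ≤ (windowAlpha h)⁻¹ := by
    rw [hα, inv_div, le_div_iff₀ hσ1]; linarith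
  calc (N : ℝ) * ε⁻¹ * (windowZeta h)⁻¹ * 2 = (N : ℝ) * ε⁻¹ * 1 * (windowZeta h)⁻¹ * 2 := by ring
    _ ≤ _ := by gcongr

end Parameters

/-! ### Difference quotients of exponentials, and grid nets. -/

/-- The entire function `(exp (i t) - 1) / t`. -/
noncomputable def expQuotient (t : ℝ) : ℂ := ∫ s in (0 : ℝ)..1, I * exp (((s * t : ℝ) : ℂ) * I)

theorem mul_expQuotient (t : ℝ) : (t : ℂ) * expQuotient t = exp ((t : ℂ) * I) - 1 := by
  rcases eq_or_ne t 0 with rfl | ht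
  · simp
  have hc : (t : ℂ) * I ≠ 0 := mul_ne_zero (by exact_mod_cast ht) I_ne_zero
  have h := integral_exp_mul_complex (a := 0) (b := 1) hc
  have e : ∀ s : ℝ, I * exp (((s * t : ℝ) : ℂ) * I) = I * exp ((t : ℂ) * I * (s : ℂ)) := by
    intro s; congr 2; push_cast; ring
  simp only [expQuotient, e]
  rw [intervalIntegral.integral_const_mul, h]
  have ht' : (t : ℂ) ≠ 0 := by exact_mod_cast ht
  simp only [ofReal_one, ofReal_zero, mul_one, mul_zero, exp_zero]
  field_simp

theorem norm_expQuotient_le (t : ℝ) : ‖expQuotient t‖ ≤ 1 := by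
  have := intervalIntegral.norm_integral_le_of_norm_le_const (a := (0 : ℝ)) (b := 1) (C := 1)
    (f := fun s : ℝ => I * exp (((s * t : ℝ) : ℂ) * I)) fun s _ => by
      rw [norm_mul, norm_I, norm_exp_ofReal_mul_I, one_mul]
  simpa [expQuotient] using this

theorem norm_exp_mul_I_sub_le (s t : ℝ) :
    ‖exp ((s : ℂ) * I) - exp ((t : ℂ) * I)‖ ≤ |s - t| := by
  have e : exp ((s : ℂ) * I) - exp ((t : ℂ) * I)
      = exp ((t : ℂ) * I) * (((s - t : ℝ) : ℂ) * expQuotient (s - t)) := by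
    rw [mul_expQuotient, mul_sub, ← exp_add, mul_one]; congr 2; push_cast; ring
  rw [e, norm_mul, norm_exp_ofReal_mul_I, one_mul, norm_mul, norm_real, Real.norm_eq_abs]
  exact mul_le_of_le_one_right (abs_nonneg _) (norm_expQuotient_le _)

theorem norm_expQuotient_sub_le (s t : ℝ) : ‖expQuotient s - expQuotient t‖ ≤ |s - t| := by
  have hi : ∀ t : ℝ, IntervalIntegrable (fun s : ℝ => I * exp (((s * t : ℝ) : ℂ) * I))
      volume 0 1 := fun t => Continuous.intervalIntegrable (by fun_prop) _ _
  rw [expQuotient, expQuotient, ← intervalIntegral.integral_sub (hi s) (hi t)]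
  have := intervalIntegral.norm_integral_le_of_norm_le_const (a := (0 : ℝ)) (b := 1)
    (C := |s - t|) (f := fun r : ℝ => I * exp (((r * s : ℝ) : ℂ) * I) -
      I * exp (((r * t : ℝ) : ℂ) * I)) fun r hr => by
      rw [Set.uIoc_of_le zero_le_one] at hr
      rw [← mul_sub, norm_mul, norm_I, one_mul]
      refine (norm_exp_mul_I_sub_le _ _).trans ?_
      rw [← mul_sub, abs_mul, abs_of_pos hr.1]
      exact mul_le_of_le_one_left (abs_nonneg _) hr.2
  simpa using this

/-- A bounded set in `ℝᵈ` has a grid-sized net inside itself, in the sup distance. -/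
theorem exists_grid_net {d : ℕ} (S : Set (Fin d → ℝ)) {R ρ : ℝ} (hR : 0 ≤ R) (hρ : 0 < ρ)
    (hS : ∀ t ∈ S, ∀ k, |t k| ≤ R) :
    ∃ T : Finset (Fin d → ℝ), (∀ t ∈ T, t ∈ S) ∧ (T.card : ℝ) ≤ (2 * (R / ρ) + 3) ^ d ∧
      ∀ t ∈ S, ∃ t' ∈ T, ∀ k, |t k - t' k| ≤ ρ := by
  classical
  set cell : (Fin d → ℝ) → Fin d → ℤ := fun t k => ⌊t k / ρ⌋ with hcell
  set m : ℕ := ⌈R / ρ⌉₊ with hm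
  have hmR : R / ρ ≤ m := Nat.le_ceil _
  set B : Finset (Fin d → ℤ) := Fintype.piFinset fun _ => Finset.Icc (-(m : ℤ)) m with hB
  have hsub : cell '' S ⊆ B := by
    rintro _ ⟨t, ht, rfl⟩
    simp only [hB, Finset.mem_coe, Fintype.mem_piFinset, Finset.mem_Icc]
    intro k
    have h1 := abs_le.1 (hS t ht k)
    have h2 : t k / ρ ≤ R / ρ := by gcongr; exact h1.2
    have h3 : -(R / ρ) ≤ t k / ρ := by rw [← neg_div]; gcongr; exact h1.1
    constructor
    · refine Int.le_floor.2 ?_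
      push_cast; linarith
    · have := (Int.floor_le (t k / ρ)).trans (h2.trans hmR)
      exact_mod_cast this
  have hfin : (cell '' S).Finite := B.finite_toSet.subset hsub
  -- One representative from each occupied cell: the net stays inside `S`, and two points of a cell
  -- differ by less than `ρ` in every coordinate.
  choose! g hgS hg using fun (c : Fin d → ℤ) (hc : c ∈ cell '' S) => hc
  refine ⟨hfin.toFinset.image g, ?_, ?_, ?_⟩
  · intro t ht
    obtain ⟨c, hc, rfl⟩ := Finset.mem_image.1 ht
    exact hgS c (hfin.mem_toFinset.1 hc)
  · have h1 : (hfin.toFinset.image g).card ≤ B.card :=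
      Finset.card_image_le.trans (Finset.card_le_card fun c hc =>
        hsub (hfin.mem_toFinset.1 hc))
    have h2 : B.card = (2 * m + 1) ^ d := by
      rw [hB, Fintype.card_piFinset_const, Int.card_Icc]
      congr 1; omega
    have h3 : (m : ℝ) < R / ρ + 1 := Nat.ceil_lt_add_one (by positivity)
    calc ((hfin.toFinset.image g).card : ℝ) ≤ ((2 * m + 1) ^ d : ℕ) := by
          rw [← h2]; exact_mod_cast h1
      _ = (2 * m + 1 : ℝ) ^ d := by push_cast; rfl
      _ ≤ _ := pow_le_pow_left₀ (by positivity) (by linarith) d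
  · intro t ht
    have hc : cell t ∈ cell '' S := ⟨t, ht, rfl⟩
    refine ⟨g (cell t), Finset.mem_image_of_mem g (hfin.mem_toFinset.2 hc), fun k => ?_⟩
    have h1 : ⌊t k / ρ⌋ = ⌊g (cell t) k / ρ⌋ := (congrFun (hg (cell t) hc) k).symm
    have h2 := (Int.abs_sub_lt_one_of_floor_eq_floor h1).le
    rw [← sub_div, abs_div, abs_of_pos hρ, div_le_one hρ] at h2
    exact h2

/-! ### Parametrization of the unit secants by six bounded real parameters. -/

section Secants

variable {N : ℕ}

/-- One entry, without its window weight, of `a x(ω) + b (x(ω + δ) - x(ω)) / δ`, where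
`a = t₀ + j t₁`, `b = t₂ + j t₃`, `ω = t₄` and `δ = t₅`; the formula also makes sense at `δ = 0`. -/
noncomputable def secantEntry (p : ℝ) (t : Fin 6 → ℝ) : ℂ :=
  exp (((t 4 * p : ℝ) : ℂ) * I) * ((t 0 + t 1 * I) + (t 2 + t 3 * I) * (p * expQuotient (t 5 * p)))

/-- The parametrized secants of the family of windowed sinusoids. -/
noncomputable def secantVector (h : Fin N → ℂ) (t : Fin 6 → ℝ) : EuclideanSpace ℂ (Fin N) :=
  WithLp.toLp 2 fun i => h i * secantEntry (centredPos N i) t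

theorem norm_add_mul_I_le (a b : ℝ) : ‖(a : ℂ) + b * I‖ ≤ |a| + |b| := by
  refine (norm_add_le _ _).trans ?_
  simp

/-- The factors are changed one at a time: phases and difference quotients are Lipschitz with
constant `B`, coefficients have modulus at most `2 R`. Only a polynomial constant is needed, since
the net size enters through its logarithm. -/
theorem norm_secantEntry_sub_le {p B R ρ : ℝ} (hp : |p| ≤ B) (hB : 1 ≤ B) (hR : 1 ≤ R)
    {t t' : Fin 6 → ℝ} (ht : ∀ k, |t k| ≤ R) (ht' : ∀ k, |t' k| ≤ R)
    (htt : ∀ k, |t k - t' k| ≤ ρ) :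
    ‖secantEntry p t - secantEntry p t'‖ ≤ 10 * R * B ^ 2 * ρ := by
  have hρ : 0 ≤ ρ := (abs_nonneg _).trans (htt 0)
  set a : ℂ := t 0 + t 1 * I with ha
  set b : ℂ := t 2 + t 3 * I with hb
  set a' : ℂ := t' 0 + t' 1 * I with ha'
  set b' : ℂ := t' 2 + t' 3 * I with hb'
  set q := expQuotient (t 5 * p) with hq
  set q' := expQuotient (t' 5 * p) with hq'
  have hq1 : ‖q‖ ≤ 1 := norm_expQuotient_le _
  have han : ‖a‖ ≤ 2 * R := (norm_add_mul_I_le _ _).trans (by linarith [ht 0, ht 1])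
  have hbn : ‖b‖ ≤ 2 * R := (norm_add_mul_I_le _ _).trans (by linarith [ht 2, ht 3])
  have hbn' : ‖b'‖ ≤ 2 * R := (norm_add_mul_I_le _ _).trans (by linarith [ht' 2, ht' 3])
  have haa : ‖a - a'‖ ≤ 2 * ρ := by
    have e : a - a' = ((t 0 - t' 0 : ℝ) : ℂ) + ((t 1 - t' 1 : ℝ) : ℂ) * I := by
      rw [ha, ha']; push_cast; ring
    rw [e]
    exact (norm_add_mul_I_le _ _).trans (by linarith [htt 0, htt 1])
  have hbb : ‖b - b'‖ ≤ 2 * ρ := by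
    have e : b - b' = ((t 2 - t' 2 : ℝ) : ℂ) + ((t 3 - t' 3 : ℝ) : ℂ) * I := by
      rw [hb, hb']; push_cast; ring
    rw [e]
    exact (norm_add_mul_I_le _ _).trans (by linarith [htt 2, htt 3])
  have hmul : ∀ k, |t k * p - t' k * p| ≤ ρ * B := fun k => by
    rw [← sub_mul, abs_mul]
    exact mul_le_mul (htt k) hp (abs_nonneg _) hρ
  have hqq : ‖q - q'‖ ≤ ρ * B := (norm_expQuotient_sub_le _ _).trans (hmul 5)
  have hee : ‖exp (((t 4 * p : ℝ) : ℂ) * I) - exp (((t' 4 * p : ℝ) : ℂ) * I)‖ ≤ ρ * B :=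
    (norm_exp_mul_I_sub_le _ _).trans (hmul 4)
  have hpn : ‖(p : ℂ)‖ ≤ B := by rwa [norm_real]
  have e : secantEntry p t - secantEntry p t'
      = (exp (((t 4 * p : ℝ) : ℂ) * I) - exp (((t' 4 * p : ℝ) : ℂ) * I)) * (a + b * (p * q))
        + exp (((t' 4 * p : ℝ) : ℂ) * I) * ((a - a') + (b - b') * (p * q)
          + b' * (p * (q - q'))) := by
    simp only [secantEntry]; ring
  rw [e]
  have hB0 : 0 ≤ B := by linarith
  calc _ ≤ ‖exp (((t 4 * p : ℝ) : ℂ) * I) - exp (((t' 4 * p : ℝ) : ℂ) * I)‖ *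
        (‖a‖ + ‖b‖ * (‖(p : ℂ)‖ * ‖q‖)) + 1 * (‖a - a'‖ + ‖b - b'‖ * (‖(p : ℂ)‖ * ‖q‖)
          + ‖b'‖ * (‖(p : ℂ)‖ * ‖q - q'‖)) := by
        refine (norm_add_le _ _).trans ?_
        rw [norm_mul, norm_mul, norm_exp_ofReal_mul_I]
        have h1 := norm_add_le a (b * (p * q))
        have h2 := norm_add₃_le (a := a - a') (b := (b - b') * (p * q)) (c := b' * (p * (q - q')))
        simp only [norm_mul] at h1 h2
        gcongr
    _ ≤ ρ * B * (2 * R + 2 * R * (B * 1)) + 1 * (2 * ρ + 2 * ρ * (B * 1)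
          + 2 * R * (B * (ρ * B))) := by gcongr
    _ = ρ * (2 * R * B + 4 * R * B ^ 2 + 2 + 2 * B) := by ring
    _ ≤ ρ * (10 * R * B ^ 2) := by
        gcongr
        have h1 : B ≤ B ^ 2 := by nlinarith
        have h2 : R * B ≤ R * B ^ 2 := by gcongr
        have h3 : B ^ 2 ≤ R * B ^ 2 := le_mul_of_one_le_left (by positivity) hR
        linarith
    _ = _ := by ring

theorem norm_toLp_mul_le {h : Fin N → ℂ} (hh : ∑ i, ‖h i‖ ^ 2 = 1) {v : Fin N → ℂ} {K : ℝ}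
    (hK : 0 ≤ K) (hv : ∀ i, ‖v i‖ ≤ K) :
    ‖(WithLp.toLp 2 fun i => h i * v i : EuclideanSpace ℂ (Fin N))‖ ≤ K := by
  refine le_of_sq_le_sq ?_ hK
  rw [EuclideanSpace.norm_sq_eq]
  calc ∑ i, ‖h i * v i‖ ^ 2 ≤ ∑ i, ‖h i‖ ^ 2 * K ^ 2 := by
        refine Finset.sum_le_sum fun i _ => ?_
        rw [norm_mul, mul_pow]
        gcongr
        exact hv i
    _ = K ^ 2 := by rw [← Finset.sum_mul, hh, one_mul]

theorem norm_secantVector_sub_le {h : Fin N → ℂ} (hN : 0 < N) (hh : ∑ i, ‖h i‖ ^ 2 = 1) {R ρ : ℝ}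
    (hR : 1 ≤ R) {t t' : Fin 6 → ℝ} (ht : ∀ k, |t k| ≤ R) (ht' : ∀ k, |t' k| ≤ R)
    (htt : ∀ k, |t k - t' k| ≤ ρ) :
    ‖secantVector h t - secantVector h t'‖ ≤ 10 * R * N ^ 2 * ρ := by
  have hρ : 0 ≤ ρ := (abs_nonneg _).trans (htt 0)
  have hN' : (1 : ℝ) ≤ N := by exact_mod_cast hN
  have e : secantVector h t - secantVector h t' = WithLp.toLp 2 fun i => h i *
      (secantEntry (centredPos N i) t - secantEntry (centredPos N i) t') := by
    ext i; simp [secantVector, mul_sub]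
  rw [e]
  refine norm_toLp_mul_le hh (by positivity) fun i => ?_
  exact norm_secantEntry_sub_le ((abs_centredPos_le i).trans (by linarith)) hN' hR ht ht' htt

theorem exp_I_mul_centredPos (ω p : ℝ) :
    exp (I * (ω : ℂ) * (p : ℂ)) = exp (((ω * p : ℝ) : ℂ) * I) := by
  congr 1; push_cast; ring

/-- Frequencies may be reduced modulo `2π` at the cost of a unit factor. -/
theorem exists_windowedSinusoid_eq_smul (h : Fin N → ℂ) (ω ω₀ : ℝ) :
    ∃ (δ : ℝ) (σ : ℂ), |δ| ≤ Real.pi ∧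
      windowedSinusoid h ω = σ • windowedSinusoid h (ω₀ + δ) := by
  have hpi := Real.pi_pos
  set k : ℤ := round ((ω - ω₀) / (2 * Real.pi)) with hk
  -- Centred positions are half-integers when `N` is even, so a shift by `2πk` may change the sign.
  -- All positions are congruent to `-(N + 1) / 2` modulo one, whence a factor common to all
  -- entries.
  refine ⟨ω - ω₀ - 2 * Real.pi * k, exp (-((Real.pi * k * ((N : ℝ) + 1) : ℝ) : ℂ) * I), ?_, ?_⟩
  · have h1 := abs_sub_round ((ω - ω₀) / (2 * Real.pi))
    rw [← hk] at h1
    have e : ω - ω₀ - 2 * Real.pi * k = ((ω - ω₀) / (2 * Real.pi) - k) * (2 * Real.pi) := by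
      field_simp
    rw [e, abs_mul, abs_of_pos (by positivity : 0 < 2 * Real.pi)]
    nlinarith
  · ext i
    simp only [windowedSinusoid, PiLp.smul_apply, smul_eq_mul]
    rw [mul_left_comm, ← exp_add]
    congr 1
    rw [exp_eq_exp_iff_exists_int]
    refine ⟨k * ((i : ℕ) + 1), ?_⟩
    simp only [centredPos]
    push_cast
    ring

theorem norm_windowedSinusoid {h : Fin N → ℂ} (hh : ∑ i, ‖h i‖ ^ 2 = 1) (ω : ℝ) :
    ‖windowedSinusoid h ω‖ = 1 := by
  have : ‖windowedSinusoid h ω‖ ^ 2 = 1 := by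
    rw [EuclideanSpace.norm_sq_eq, ← hh]
    refine Finset.sum_congr rfl fun i _ => ?_
    simp only [windowedSinusoid]
    rw [norm_mul, exp_I_mul_centredPos, norm_exp_ofReal_mul_I, mul_one]
  exact (pow_eq_one_iff_of_nonneg (norm_nonneg _) two_ne_zero).1 this

theorem inner_windowedSinusoid (h : Fin N → ℂ) (ω δ : ℝ) :
    inner ℂ (windowedSinusoid h ω) (windowedSinusoid h (ω + δ)) = windowSpectrum h δ := by
  rw [PiLp.inner_apply, windowSpectrum]
  refine Finset.sum_congr rfl fun i _ => ?_
  simp only [windowedSinusoid, RCLike.inner_apply, map_mul, exp_I_mul_centredPos]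
  rw [← Complex.exp_conj]
  have e1 : (starRingEnd ℂ) (((ω * centredPos N i : ℝ) : ℂ) * I)
      = -(((ω * centredPos N i : ℝ) : ℂ) * I) := by
    rw [map_mul, conj_I, conj_ofReal]; ring
  rw [e1]
  have e2 : ((‖h i‖ ^ 2 : ℝ) : ℂ) = h i * (starRingEnd ℂ) (h i) := by
    rw [mul_conj, Complex.normSq_eq_norm_sq]
  have e3 : exp (((δ * centredPos N i : ℝ) : ℂ) * I)
      = exp ((((ω + δ) * centredPos N i : ℝ) : ℂ) * I) *
        exp (-(((ω * centredPos N i : ℝ) : ℂ) * I)) := by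
    rw [← exp_add]; congr 1; push_cast; ring
  rw [e2, e3]; ring

/-- The gain of the second sinusoid is controlled by the norm of the difference. -/
theorem norm_sq_mul_one_sub_windowPower_le {h : Fin N → ℂ} (hh : ∑ i, ‖h i‖ ^ 2 = 1) (g₁ g₂ : ℂ)
    (ω δ : ℝ) :
    ‖g₂‖ ^ 2 * (1 - windowPower h δ) ≤
      ‖g₁ • windowedSinusoid h ω - g₂ • windowedSinusoid h (ω + δ)‖ ^ 2 := by
  have hre : RCLike.re (inner ℂ (g₁ • windowedSinusoid h ω) (g₂ • windowedSinusoid h (ω + δ)))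
      ≤ ‖g₁‖ * (‖g₂‖ * ‖windowSpectrum h δ‖) := by
    refine (RCLike.re_le_norm _).trans (le_of_eq ?_)
    rw [inner_smul_left, inner_smul_right, inner_windowedSinusoid, norm_mul, norm_mul,
      RCLike.norm_conj]
  rw [norm_sub_sq (𝕜 := ℂ), norm_smul, norm_smul, norm_windowedSinusoid hh,
    norm_windowedSinusoid hh, windowPower]
  -- Completing the square in `‖g₁‖`; geometrically, the distance from `g₂ x(ω + δ)` to the complex
  -- line of `x(ω)`.
  nlinarith [sq_nonneg (‖g₁‖ - ‖g₂‖ * ‖windowSpectrum h δ‖)]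

theorem windowedSinusoid_add_apply (h : Fin N → ℂ) (ω δ : ℝ) (i : Fin N) :
    windowedSinusoid h (ω + δ) i = h i * (exp (((ω * centredPos N i : ℝ) : ℂ) * I) *
      (1 + δ * (centredPos N i * expQuotient (δ * centredPos N i)))) := by
  have e := mul_expQuotient (δ * centredPos N i)
  have e2 : (δ : ℂ) * (centredPos N i * expQuotient (δ * centredPos N i))
      = exp (((δ * centredPos N i : ℝ) : ℂ) * I) - 1 := by
    rw [← e]; push_cast; ring
  simp only [windowedSinusoid, exp_I_mul_centredPos]
  rw [e2, add_sub_cancel, ← exp_add]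
  congr 2; push_cast; ring

/-- Every unit secant has a parametrization with polynomially bounded parameters. -/
theorem exists_secantVector_eq {h : Fin N → ℂ} (hN : 0 < N) (hh : ∑ i, ‖h i‖ ^ 2 = 1) {κ : ℝ}
    (hκ : 0 < κ) (hκ1 : κ ≤ 1)
    (hsep : ∀ δ : ℝ, |δ| ≤ Real.pi → κ * δ ^ 2 ≤ 1 - windowPower h δ) (g₁ g₂ : ℂ) (ω₁ ω₂ : ℝ)
    (hv : ‖g₁ • windowedSinusoid h ω₁ - g₂ • windowedSinusoid h ω₂‖ = 1) :
    ∃ t : Fin 6 → ℝ, (∀ k, |t k| ≤ 4 * N / κ) ∧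
      secantVector h t = g₁ • windowedSinusoid h ω₁ - g₂ • windowedSinusoid h ω₂ := by
  have hN' : (1 : ℝ) ≤ N := by exact_mod_cast hN
  have hκi : 1 ≤ κ⁻¹ := (one_le_inv₀ hκ).2 hκ1
  obtain ⟨ω, σ₁, hω, e1⟩ := exists_windowedSinusoid_eq_smul h ω₁ 0
  rw [zero_add] at e1
  obtain ⟨δ, σ₂, hδ, e2⟩ := exists_windowedSinusoid_eq_smul h ω₂ ω
  rw [e1, e2, smul_smul, smul_smul] at hv ⊢
  set a₁ := g₁ * σ₁ with ha₁
  set a₂ := g₂ * σ₂ with ha₂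
  -- The regular coordinates of the secant: `a₁` and `a₂` may nearly cancel and be huge, while `a`
  -- and `b` stay bounded.
  set a := a₁ - a₂ with ha
  set b := -(a₂ * δ) with hb
  have hbn : ‖b‖ ≤ κ⁻¹ := by
    have h1 := norm_sq_mul_one_sub_windowPower_le hh a₁ a₂ ω δ
    rw [hv] at h1
    have h2 : ‖b‖ ^ 2 = ‖a₂‖ ^ 2 * δ ^ 2 := by
      rw [hb, norm_neg, norm_mul, norm_real, mul_pow, Real.norm_eq_abs, sq_abs]
    have h3 : κ * ‖b‖ ^ 2 ≤ 1 := by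
      calc κ * ‖b‖ ^ 2 = ‖a₂‖ ^ 2 * (κ * δ ^ 2) := by rw [h2]; ring
        _ ≤ ‖a₂‖ ^ 2 * (1 - windowPower h δ) := by gcongr; exact hsep δ hδ
        _ ≤ 1 := by simpa using h1
    refine le_of_sq_le_sq ?_ (by positivity)
    have h4 : ‖b‖ ^ 2 ≤ κ⁻¹ := by
      rw [← one_div, le_div_iff₀ hκ]; linarith
    nlinarith
  have hent : a₁ • windowedSinusoid h ω - a₂ • windowedSinusoid h (ω + δ)
      = a • windowedSinusoid h ω + b • WithLp.toLp 2 fun i => h i *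
        (exp (((ω * centredPos N i : ℝ) : ℂ) * I) *
          (centredPos N i * expQuotient (δ * centredPos N i))) := by
    ext i
    simp only [PiLp.sub_apply, PiLp.add_apply, PiLp.smul_apply, smul_eq_mul,
      windowedSinusoid_add_apply]
    simp only [windowedSinusoid, exp_I_mul_centredPos, ha, hb]
    ring
  -- The difference quotient has norm at most `N`, so a unit secant forces `‖a‖ ≤ 1 + N ‖b‖`.
  have han : ‖a‖ ≤ 2 * N * κ⁻¹ := by
    have hq : ‖(WithLp.toLp 2 fun i => h i * (exp (((ω * centredPos N i : ℝ) : ℂ) * I) *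
        (centredPos N i * expQuotient (δ * centredPos N i))) : EuclideanSpace ℂ (Fin N))‖ ≤ N := by
      refine norm_toLp_mul_le hh (by positivity) fun i => ?_
      rw [norm_mul, norm_exp_ofReal_mul_I, one_mul, norm_mul, norm_real, Real.norm_eq_abs]
      calc _ ≤ (N : ℝ) * 1 := by
            gcongr
            · exact (abs_centredPos_le i).trans (by linarith)
            · exact norm_expQuotient_le _
        _ = N := mul_one _
    rw [hent] at hv
    have h1 := norm_sub_le_norm_add (a • windowedSinusoid h ω) (b • WithLp.toLp 2 fun i => h i *
        (exp (((ω * centredPos N i : ℝ) : ℂ) * I) *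
          (centredPos N i * expQuotient (δ * centredPos N i))) : EuclideanSpace ℂ (Fin N))
    rw [hv, norm_smul, norm_smul, norm_windowedSinusoid hh, mul_one] at h1
    have h2 := mul_le_mul hbn hq (norm_nonneg _) (by positivity)
    nlinarith
  have hR : 2 * N * κ⁻¹ ≤ 4 * N / κ := by
    rw [div_eq_mul_inv]; gcongr; norm_num
  have hb' : κ⁻¹ ≤ 4 * N / κ := by
    rw [div_eq_mul_inv]; nlinarith
  have hpi : Real.pi ≤ 4 * N / κ := by
    rw [div_eq_mul_inv]; nlinarith [Real.pi_le_four]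
  refine ⟨![a.re, a.im, b.re, b.im, ω, δ], ?_, ?_⟩
  · intro k
    fin_cases k
    · exact ((abs_re_le_norm a).trans han).trans hR
    · exact ((abs_im_le_norm a).trans han).trans hR
    · exact ((abs_re_le_norm b).trans hbn).trans hb'
    · exact ((abs_im_le_norm b).trans hbn).trans hb'
    · exact hω.trans hpi
    · exact hδ.trans hpi
  · rw [hent]
    ext i
    simp only [secantVector, secantEntry, PiLp.add_apply, PiLp.smul_apply, smul_eq_mul,
      windowedSinusoid, exp_I_mul_centredPos]
    simp only [Matrix.cons_val, re_add_im]
    ring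

end Secants

/-! ### From the net to all secants, and the union bound. -/

section Isometry

variable {M N : ℕ}

theorem toEuclideanLin_labelMatrix_apply (e : Fin M → Fin N → Fin 4) (v : EuclideanSpace ℂ (Fin N))
    (m : Fin M) : Matrix.toEuclideanLin (labelMatrix e) v m
      = ((1 / √(N : ℝ) : ℝ) : ℂ) * rowSum (fun n => v n) (e m) := by
  rw [Matrix.toLpLin_apply]
  simp only [Matrix.mulVec, dotProduct, labelMatrix, rowSum, Finset.mul_sum]
  exact Finset.sum_congr rfl fun n _ => by ring

theorem sqrt_mul_norm_toEuclideanLin_labelMatrix (hN : 0 < N) (e : Fin M → Fin N → Fin 4)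
    (v : EuclideanSpace ℂ (Fin N)) :
    √((N : ℝ) / M) * ‖Matrix.toEuclideanLin (labelMatrix e) v‖
      = √(matrixEnergy (fun n => v n) e) / √M := by
  have hN' : (0 : ℝ) < N := by exact_mod_cast hN
  have h1 : ‖Matrix.toEuclideanLin (labelMatrix e) v‖ ^ 2
      = matrixEnergy (fun n => v n) e / N := by
    rw [EuclideanSpace.norm_sq_eq, matrixEnergy, Finset.sum_div]
    refine Finset.sum_congr rfl fun m _ => ?_
    rw [toEuclideanLin_labelMatrix_apply, norm_mul, norm_real, mul_pow, Real.norm_eq_abs, sq_abs,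
      div_pow, Real.sq_sqrt hN'.le]
    ring
  rw [← Real.sqrt_sq (norm_nonneg (Matrix.toEuclideanLin (labelMatrix e) v)), h1,
    ← Real.sqrt_mul (by positivity), ← Real.sqrt_div' _ (Nat.cast_nonneg M)]
  congr 1
  field_simp

/-- Cauchy–Schwarz in each row, for every choice of labels. Its loss of `√N` in the norm is met by a
net of resolution `ε / (2 N)`. -/
theorem matrixEnergy_le (e : Fin M → Fin N → Fin 4) (v : EuclideanSpace ℂ (Fin N)) :
    matrixEnergy (fun n => v n) e ≤ N * ‖v‖ ^ 2 * M := by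
  have hroot : ∀ k, ‖fourthRoot k‖ = 1 := by
    intro k; fin_cases k <;> simp [fourthRoot]
  have hrow : ∀ m, ‖rowSum (fun n => v n) (e m)‖ ^ 2 ≤ N * ‖v‖ ^ 2 := by
    intro m
    have h1 : ‖rowSum (fun n => v n) (e m)‖ ≤ ∑ n, ‖v n‖ := by
      refine (norm_sum_le _ _).trans (Finset.sum_le_sum fun n _ => ?_)
      rw [norm_mul, hroot, one_mul]
    have h2 := sq_sum_le_card_mul_sum_sq (s := Finset.univ) (f := fun n => ‖v n‖)
    rw [Finset.card_univ, Fintype.card_fin] at h2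
    rw [EuclideanSpace.norm_sq_eq]
    exact (pow_le_pow_left₀ (norm_nonneg _) h1 2).trans h2
  calc matrixEnergy (fun n => v n) e ≤ ∑ _m : Fin M, N * ‖v‖ ^ 2 :=
        Finset.sum_le_sum fun m _ => hrow m
    _ = _ := by rw [Finset.sum_const, Finset.card_univ, Fintype.card_fin, nsmul_eq_mul]; ring

theorem sqrt_mul_norm_toEuclideanLin_labelMatrix_le (hN : 0 < N) (e : Fin M → Fin N → Fin 4)
    (v : EuclideanSpace ℂ (Fin N)) :
    √((N : ℝ) / M) * ‖Matrix.toEuclideanLin (labelMatrix e) v‖ ≤ √N * ‖v‖ := by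
  rw [sqrt_mul_norm_toEuclideanLin_labelMatrix hN]
  refine div_le_of_le_mul₀ (by positivity) (by positivity) ?_
  have h := Real.sqrt_le_sqrt (matrixEnergy_le e v)
  rwa [Real.sqrt_mul (by positivity), Real.sqrt_mul (by positivity),
    Real.sqrt_sq (norm_nonneg v)] at h

theorem IsPairwiseIsometry.of_norm_eq_one {A : Matrix (Fin M) (Fin N) ℂ} {h : Fin N → ℂ} {ε : ℝ}
    (H : ∀ (g₁ g₂ : ℂ) (ω₁ ω₂ : ℝ),
      ‖g₁ • windowedSinusoid h ω₁ - g₂ • windowedSinusoid h ω₂‖ = 1 →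
      1 - ε ≤ √((N : ℝ) / M) * ‖Matrix.toEuclideanLin A
        (g₁ • windowedSinusoid h ω₁ - g₂ • windowedSinusoid h ω₂)‖ ∧
      √((N : ℝ) / M) * ‖Matrix.toEuclideanLin A
        (g₁ • windowedSinusoid h ω₁ - g₂ • windowedSinusoid h ω₂)‖ ≤ 1 + ε) :
    IsPairwiseIsometry A h ε := by
  intro g₁ g₂ ω₁ ω₂ hv
  have e : g₁ • Matrix.toEuclideanLin A (windowedSinusoid h ω₁) -
      g₂ • Matrix.toEuclideanLin A (windowedSinusoid h ω₂)
      = Matrix.toEuclideanLin A (g₁ • windowedSinusoid h ω₁ - g₂ • windowedSinusoid h ω₂) := by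
    rw [map_sub, map_smul, map_smul]
  rw [e]
  set v := g₁ • windowedSinusoid h ω₁ - g₂ • windowedSinusoid h ω₂ with hvd
  have hv0 : 0 < ‖v‖ := norm_pos_iff.2 hv
  have e2 : ((‖v‖⁻¹ : ℝ) : ℂ) • v = (((‖v‖⁻¹ : ℝ) : ℂ) * g₁) • windowedSinusoid h ω₁ -
      (((‖v‖⁻¹ : ℝ) : ℂ) * g₂) • windowedSinusoid h ω₂ := by
    rw [hvd, smul_sub, smul_smul, smul_smul]
  have h1 := H _ _ ω₁ ω₂ (by
    rw [← e2, norm_smul, norm_real, norm_inv, norm_norm, inv_mul_cancel₀ hv0.ne'])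
  rw [← e2, map_smul, norm_smul, norm_real, norm_inv, norm_norm, inv_mul_eq_div] at h1
  exact h1

/-- Once the norm deviates little on a net of the unit secants, the matrix is an isometry for
all of them. -/
theorem isPairwiseIsometry_of_net (hN : 0 < N) (hM : 0 < M) {h : Fin N → ℂ} {ε : ℝ}
    (hε : 0 < ε) {T : Set (EuclideanSpace ℂ (Fin N))} (e : Fin M → Fin N → Fin 4)
    (hnet : ∀ (g₁ g₂ : ℂ) (ω₁ ω₂ : ℝ),
      ‖g₁ • windowedSinusoid h ω₁ - g₂ • windowedSinusoid h ω₂‖ = 1 →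
      ∃ y ∈ T, ‖g₁ • windowedSinusoid h ω₁ - g₂ • windowedSinusoid h ω₂ - y‖ ≤ ε / (2 * N))
    (hT : ∀ y ∈ T, (1 - ε / 2) * √M ≤ √(matrixEnergy (fun n => y n) e) ∧
      √(matrixEnergy (fun n => y n) e) ≤ (1 + ε / 2) * √M) :
    IsPairwiseIsometry (labelMatrix e) h ε := by
  have hN' : (1 : ℝ) ≤ N := by exact_mod_cast hN
  have hM' : 0 < √(M : ℝ) := by positivity
  refine IsPairwiseIsometry.of_norm_eq_one fun g₁ g₂ ω₁ ω₂ hv => ?_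
  obtain ⟨y, hy, hyv⟩ := hnet g₁ g₂ ω₁ ω₂ hv
  set v := g₁ • windowedSinusoid h ω₁ - g₂ • windowedSinusoid h ω₂
  obtain ⟨hl, hu⟩ := hT y hy
  rw [← le_div_iff₀ hM', ← sqrt_mul_norm_toEuclideanLin_labelMatrix hN] at hl
  rw [← div_le_iff₀ hM', ← sqrt_mul_norm_toEuclideanLin_labelMatrix hN] at hu
  have hd := sqrt_mul_norm_toEuclideanLin_labelMatrix_le hN e (v - y)
  have hd2 : √(N : ℝ) * ‖v - y‖ ≤ ε / 2 := by
    have hs : √(N : ℝ) ≤ N := Real.sqrt_le_iff.2 ⟨by positivity, by nlinarith⟩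
    calc √(N : ℝ) * ‖v - y‖ ≤ N * (ε / (2 * N)) := by gcongr
      _ = ε / 2 := by field_simp
  set L := Matrix.toEuclideanLin (labelMatrix e)
  have htri : |‖L v‖ - ‖L y‖| ≤ ‖L (v - y)‖ := by
    rw [map_sub L v y]; exact abs_norm_sub_norm_le (L v) (L y)
  have hs0 : 0 ≤ √((N : ℝ) / M) := Real.sqrt_nonneg _
  have h1 : √((N : ℝ) / M) * ‖L v‖ - √((N : ℝ) / M) * ‖L y‖ ≤ √((N : ℝ) / M) * ‖L (v - y)‖ := by
    rw [← mul_sub]; gcongr; exact (le_abs_self _).trans htri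
  have h2 : √((N : ℝ) / M) * ‖L y‖ - √((N : ℝ) / M) * ‖L v‖ ≤ √((N : ℝ) / M) * ‖L (v - y)‖ := by
    rw [← mul_sub]; gcongr; exact (le_abs_self _).trans (by rwa [abs_sub_comm])
  constructor <;> linarith

/-- A finite net of the unit secants. -/
theorem exists_secant_net {h : Fin N → ℂ} (hN : 0 < N) (hh : ∑ i, ‖h i‖ ^ 2 = 1) {κ : ℝ}
    (hκ : 0 < κ) (hκ1 : κ ≤ 1)
    (hsep : ∀ δ : ℝ, |δ| ≤ Real.pi → κ * δ ^ 2 ≤ 1 - windowPower h δ) {ε : ℝ} (hε : 0 < ε)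
    (hεN : ε ≤ N) :
    ∃ T : Finset (EuclideanSpace ℂ (Fin N)), (∀ y ∈ T, ‖y‖ = 1) ∧
      (T.card : ℝ) ≤ (1000 * N ^ 5 * κ⁻¹ ^ 2 * ε⁻¹) ^ 6 ∧
      ∀ (g₁ g₂ : ℂ) (ω₁ ω₂ : ℝ),
        ‖g₁ • windowedSinusoid h ω₁ - g₂ • windowedSinusoid h ω₂‖ = 1 →
        ∃ y ∈ T, ‖g₁ • windowedSinusoid h ω₁ - g₂ • windowedSinusoid h ω₂ - y‖ ≤ ε / (2 * N) := by
  classical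
  have hN' : (1 : ℝ) ≤ N := by exact_mod_cast hN
  have hκi : 1 ≤ κ⁻¹ := (one_le_inv₀ hκ).2 hκ1
  set R : ℝ := 4 * N / κ with hR
  have hR1 : 1 ≤ R := by rw [hR, div_eq_mul_inv]; nlinarith
  -- Chosen so that the Lipschitz bound `10 R N² ρ` equals `ε / (2 N)`.
  set ρ : ℝ := ε / (20 * R * N ^ 3) with hρ
  have hρ0 : 0 < ρ := by positivity
  -- The grid is taken inside the parameters of unit vectors, since concentration is available for
  -- unit vectors only.
  obtain ⟨T, hTS, hcard, hnet⟩ := exists_grid_net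
    {t : Fin 6 → ℝ | (∀ k, |t k| ≤ R) ∧ ‖secantVector h t‖ = 1} (by linarith) hρ0
    (fun t ht => ht.1)
  refine ⟨T.image (secantVector h), ?_, ?_, ?_⟩
  · intro y hy
    obtain ⟨t, ht, rfl⟩ := Finset.mem_image.1 hy
    exact (hTS t ht).2
  · have h1 : ((T.image (secantVector h)).card : ℝ) ≤ T.card := by
      exact_mod_cast Finset.card_image_le
    refine (h1.trans hcard).trans (pow_le_pow_left₀ (by positivity) ?_ 6)
    have e : R / ρ = 320 * (N ^ 5 * κ⁻¹ ^ 2 * ε⁻¹) := by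
      rw [hρ, hR]; field_simp; ring
    have h2 : 1 ≤ (N : ℝ) ^ 5 * κ⁻¹ ^ 2 * ε⁻¹ := by
      have h3 : 1 ≤ N * ε⁻¹ := by rw [← div_eq_mul_inv]; exact (one_le_div hε).2 hεN
      have h4 : 1 ≤ (N : ℝ) ^ 4 := one_le_pow₀ hN'
      have h5 : 1 ≤ κ⁻¹ ^ 2 := one_le_pow₀ hκi
      calc (1 : ℝ) = 1 * 1 * 1 := by norm_num
        _ ≤ (N : ℝ) ^ 4 * κ⁻¹ ^ 2 * (N * ε⁻¹) := by gcongr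
        _ = _ := by ring
    rw [e]; nlinarith
  · intro g₁ g₂ ω₁ ω₂ hv
    obtain ⟨t, ht, htv⟩ := exists_secantVector_eq hN hh hκ hκ1 hsep g₁ g₂ ω₁ ω₂ hv
    rw [← htv] at hv ⊢
    obtain ⟨t', ht', htt⟩ := hnet t ⟨ht, hv⟩
    refine ⟨_, Finset.mem_image_of_mem _ ht', ?_⟩
    refine (norm_secantVector_sub_le hN hh hR1 ht (hTS t' ht').1 htt).trans (le_of_eq ?_)
    rw [hρ]; field_simp; ring

/-- Failure probability of the pairwise isometry in the canonical model. -/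
theorem le_measureReal_isPairwiseIsometry {h : Fin N → ℂ} (hN : 0 < N) (hM : 0 < M)
    (hh : ∑ i, ‖h i‖ ^ 2 = 1) {κ : ℝ} (hκ : 0 < κ) (hκ1 : κ ≤ 1)
    (hsep : ∀ δ : ℝ, |δ| ≤ Real.pi → κ * δ ^ 2 ≤ 1 - windowPower h δ) {ε : ℝ} (hε : 0 < ε)
    (hεN : ε ≤ N) :
    1 - 2 * (1000 * N ^ 5 * κ⁻¹ ^ 2 * ε⁻¹) ^ 6 * Real.exp (-(1 / 4096 * ε ^ 2 * M)) ≤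
      (labelMatrixMeasure M N).real
        {e | labelMatrix e ∈ {A : Matrix (Fin M) (Fin N) ℂ | IsPairwiseIsometry A h ε}} := by
  obtain ⟨T, hT1, hcard, hnet⟩ := exists_secant_net hN hh hκ hκ1 hsep hε hεN
  set bad : EuclideanSpace ℂ (Fin N) → Set (Fin M → Fin N → Fin 4) := fun y =>
    {e | ¬ ((1 - ε / 2) * √M ≤ √(matrixEnergy (fun n => y n) e) ∧
      √(matrixEnergy (fun n => y n) e) ≤ (1 + ε / 2) * √M)} with hbad
  set good : Set (Fin M → Fin N → Fin 4) :=
    {e | labelMatrix e ∈ {A : Matrix (Fin M) (Fin N) ℂ | IsPairwiseIsometry A h ε}} with hgood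
  have hcover : Set.univ ⊆ good ∪ ⋃ y ∈ T, bad y := by
    intro e _
    by_cases hb : e ∈ ⋃ y ∈ T, bad y
    · exact Or.inr hb
    · left
      refine isPairwiseIsometry_of_net hN hM hε (T := T) e hnet fun y hy => ?_
      by_contra hc
      exact hb (Set.mem_biUnion hy hc)
  have h1 : (1 : ℝ) ≤ (labelMatrixMeasure M N).real good
      + (labelMatrixMeasure M N).real (⋃ y ∈ T, bad y) := by
    rw [← probReal_univ (μ := labelMatrixMeasure M N)]
    exact (measureReal_mono hcover).trans (measureReal_union_le _ _)
  have h2 : (labelMatrixMeasure M N).real (⋃ y ∈ T, bad y)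
      ≤ T.card * (2 * Real.exp (-(1 / 4096 * ε ^ 2 * M))) := by
    refine (measureReal_biUnion_finset_le T bad).trans ?_
    rw [← nsmul_eq_mul, ← Finset.sum_const]
    refine Finset.sum_le_sum fun y hy => ?_
    have h3 := matrixEnergy_tail (M := M) (fun n => y n)
      (by rw [← EuclideanSpace.norm_sq_eq, hT1 y hy, one_pow]) (t := ε / 2) (by positivity)
    refine h3.trans (le_of_eq ?_)
    congr 2; ring
  have h4 : T.card * (2 * Real.exp (-(1 / 4096 * ε ^ 2 * M))) ≤
      (1000 * N ^ 5 * κ⁻¹ ^ 2 * ε⁻¹) ^ 6 * (2 * Real.exp (-(1 / 4096 * ε ^ 2 * M))) := by gcongr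
  linarith

end Isometry

/-! ### Comparing the net size with the sample bound. -/

/-- Used with `n = N`, `k = κ⁻¹`, `e = ε⁻¹` and `L` the argument of the logarithm. The powers of `L`
add up to `6 (10 + 2 + 1) = 78`, and `log L ≥ 1` absorbs the constant factor into the exponent. -/
theorem two_mul_net_bound_le_exp {n k e b L : ℝ} (hn : 0 ≤ n) (hb : 1 ≤ b) (hL : 8 ≤ L)
    (hk : 0 ≤ k) (he : 0 ≤ e) (hnL : n ≤ L ^ 2) (hkL : k ≤ b * L) (heL : e ≤ L) :
    2 * (1000 * n ^ 5 * k ^ 2 * e) ^ 6 ≤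
      Real.exp ((Real.log (2 * (1000 * b ^ 2) ^ 6) + 78) * Real.log L) := by
  have hl1 : 1 ≤ Real.log L := by
    rw [Real.le_log_iff_exp_le (by linarith)]
    linarith [Real.exp_one_lt_d9]
  have hB1 : 1 ≤ 1000 * b ^ 2 := by nlinarith
  set B := 1000 * b ^ 2 with hB
  have hB6 : 1 ≤ 2 * B ^ 6 := by linarith [one_le_pow₀ hB1 (n := 6)]
  have hlog0 : 0 ≤ Real.log (2 * B ^ 6) := Real.log_nonneg hB6
  have h1 : 1000 * n ^ 5 * k ^ 2 * e ≤ B * L ^ 13 := by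
    calc _ ≤ 1000 * (L ^ 2) ^ 5 * (b * L) ^ 2 * L := by gcongr
      _ = _ := by rw [hB]; ring
  calc _ ≤ 2 * (B * L ^ 13) ^ 6 := by gcongr
    _ = 2 * B ^ 6 * L ^ 78 := by ring
    _ = Real.exp (Real.log (2 * B ^ 6)) * Real.exp (78 * Real.log L) := by
        rw [Real.exp_log (by linarith)]
        congr 1
        rw [show (78 : ℝ) = ((78 : ℕ) : ℝ) by norm_num, Real.exp_nat_mul,
          Real.exp_log (by linarith)]
    _ ≤ Real.exp (Real.log (2 * B ^ 6) * Real.log L) * Real.exp (78 * Real.log L) := by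
        gcongr
        exact le_mul_of_one_le_right hlog0 hl1
    _ = _ := by rw [← Real.exp_add]; congr 1; ring

/-- Pairwise isometry for a single windowed sinusoid, for all gains and all frequency pairs.
The constants `C` and `c` depend only on the side-lobe bound `D`; since `M` is at least
`C ε⁻² log L`, the failure probability `exp (-c ε² M)` is at most `L ^ (-c C)`. -/
theorem theorem5 (D : ℝ) (hD : D < 1) :
    ∃ C : ℝ, 0 < C ∧ ∃ c : ℝ, 0 < c ∧
      ∀ (N : ℕ) (h : Fin N → ℂ),
        ∑ i, ‖h i‖ ^ 2 = 1 →
        SidelobesBelow h D →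
        AntitoneOn (windowPower h) (Set.Ioo 0 (Real.pi / (2 * (N : ℝ)))) →
        ∀ ε : ℝ, 0 < ε →
        ∀ M : ℕ,
          C * (ε ^ 2)⁻¹ *
              Real.log ((N : ℝ) * ε⁻¹ * (1 - windowTau h * windowChi h)⁻¹ *
                (windowZeta h)⁻¹ * (windowAlpha h)⁻¹) ≤ (M : ℝ) →
          ∀ {Ω : Type*} [MeasurableSpace Ω] (P : Measure Ω) [IsProbabilityMeasure P]
            (A : Ω → Matrix (Fin M) (Fin N) ℂ),
            IsRandomPhaseMatrix P A →
            1 - Real.exp (-(c * ε ^ 2 * (M : ℝ))) ≤ P.real {s | IsPairwiseIsometry (A s) h ε} := by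
  have hd0 : 0 < min (1 - D) 1 := lt_min (by linarith) zero_lt_one
  have hd1 : min (1 - D) 1 ≤ 1 := min_le_right _ _
  set d := min (1 - D) 1 with hd
  have hpi := Real.pi_pos
  have hpi1 : 1 ≤ Real.pi ^ 2 / d := (one_le_div hd0).2 (by nlinarith [Real.pi_gt_three])
  have hB1 : 1 ≤ 1000 * (Real.pi ^ 2 / d) ^ 2 := by nlinarith
  have hlog0 : 0 ≤ Real.log (2 * (1000 * (Real.pi ^ 2 / d) ^ 2) ^ 6) :=
    Real.log_nonneg (by linarith [one_le_pow₀ hB1 (n := 6)])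
  obtain ⟨C₁, hC₁⟩ : ∃ C₁, C₁ = Real.log (2 * (1000 * (Real.pi ^ 2 / d) ^ 2) ^ 6) + 78 := ⟨_, rfl⟩
  have hC₁0 : 0 < C₁ := by linarith
  -- Half of the exponent `ε² M / 4096` pays for the net, of cost `C₁ log L`; the other half remains
  -- as the failure probability.
  refine ⟨8192 * C₁, by positivity, 1 / 8192, by norm_num, ?_⟩
  intro N h hh hS _ ε hε M hM Ω _ P _ A hA
  have hN : 0 < N := by
    rcases Nat.eq_zero_or_pos N with rfl | hN
    · simp at hh
    · exact hN
  have hN' : (1 : ℝ) ≤ N := by exact_mod_cast hN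
  refine le_trans ?_ (hA.le_measureReal hN {B | IsPairwiseIsometry B h ε})
  -- For `ε ≥ √N` every matrix qualifies: `1 - ε ≤ 0` and the ratio is at most `√N`. This covers `M
  -- = 0`, where `N / M` is `0`. Otherwise `√N ≤ N ε⁻¹`, which is what bounds `N` by `L²`.
  rcases le_or_gt (√(N : ℝ)) ε with hεN | hεN
  · have hall : {e : Fin M → Fin N → Fin 4 |
        labelMatrix e ∈ {B : Matrix (Fin M) (Fin N) ℂ | IsPairwiseIsometry B h ε}} = Set.univ := by
      refine Set.eq_univ_of_forall fun e => ?_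
      refine IsPairwiseIsometry.of_norm_eq_one fun g₁ g₂ ω₁ ω₂ hv => ?_
      have h1 := sqrt_mul_norm_toEuclideanLin_labelMatrix_le hN e
        (g₁ • windowedSinusoid h ω₁ - g₂ • windowedSinusoid h ω₂)
      rw [hv, mul_one] at h1
      have h2 : 1 ≤ √(N : ℝ) := Real.one_le_sqrt.2 hN'
      exact ⟨(by linarith : 1 - ε ≤ 0).trans (by positivity), by linarith⟩
    rw [hall, probReal_univ]
    linarith [Real.exp_pos (-(1 / 8192 * ε ^ 2 * (M : ℝ)))]
  have hW := windowSpread_pos hh hD hS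
  have hz : 0 < windowZeta h := by rw [windowZeta_eq]; positivity
  have hz4 := windowZeta_le hN hh
  have harg := le_log_argument hN hh hW hε
  generalize (N : ℝ) * ε⁻¹ * (1 - windowTau h * windowChi h)⁻¹ * (windowZeta h)⁻¹ *
    (windowAlpha h)⁻¹ = L at harg hM
  have hsN : 1 ≤ √(N : ℝ) := Real.one_le_sqrt.2 hN'
  have hss : √(N : ℝ) * √(N : ℝ) = N := Real.mul_self_sqrt (by positivity)
  have hNε : √(N : ℝ) ≤ N * ε⁻¹ := by
    rw [← div_eq_mul_inv, le_div_iff₀ hε]; nlinarith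
  have hzi : 4 ≤ (windowZeta h)⁻¹ := by
    rw [← one_div, le_div_iff₀ hz]; linarith
  have hLz : (windowZeta h)⁻¹ ≤ L := by
    refine le_trans ?_ harg
    calc (windowZeta h)⁻¹ = 1 * (windowZeta h)⁻¹ * 1 := by ring
      _ ≤ N * ε⁻¹ * (windowZeta h)⁻¹ * 2 := by gcongr <;> linarith
  have hLN : 8 * (N * ε⁻¹) ≤ L := by
    refine le_trans ?_ harg
    calc 8 * (N * ε⁻¹) = N * ε⁻¹ * 4 * 2 := by ring
      _ ≤ _ := by gcongr
  have hL8 : 8 ≤ L := by linarith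
  have hNL : (N : ℝ) ≤ L ^ 2 := by
    rw [← hss, sq]
    have : √(N : ℝ) ≤ L := by linarith
    gcongr
  have hεL : ε⁻¹ ≤ L := by
    have : 1 * ε⁻¹ ≤ N * ε⁻¹ := by gcongr
    linarith
  have hl1 : 1 ≤ Real.log L := by
    rw [Real.le_log_iff_exp_le (by linarith)]
    linarith [Real.exp_one_lt_d9]
  set κ : ℝ := d * windowZeta h / Real.pi ^ 2 with hκd
  have hκ0 : 0 < κ := by positivity
  have hκ1 : κ ≤ 1 := by
    rw [hκd, div_le_one (by positivity)]; nlinarith [Real.pi_gt_three]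
  have hκi : κ⁻¹ ≤ Real.pi ^ 2 / d * L := by
    have : κ⁻¹ = Real.pi ^ 2 / d * (windowZeta h)⁻¹ := by rw [hκd]; field_simp
    rw [this]; gcongr
  have hεN' : ε ≤ N := hεN.le.trans (Real.sqrt_le_iff.2 ⟨by positivity, by nlinarith⟩)
  have hε2 : 0 < ε ^ 2 := by positivity
  have hMε : 8192 * C₁ * Real.log L ≤ ε ^ 2 * M := by
    calc 8192 * C₁ * Real.log L = ε ^ 2 * (8192 * C₁ * (ε ^ 2)⁻¹ * Real.log L) := by field_simp
      _ ≤ _ := by gcongr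
  have hMpos : 0 < M := by
    rcases Nat.eq_zero_or_pos M with rfl | h0
    · have : 0 < 8192 * C₁ * Real.log L := by positivity
      simp at hMε; linarith
    · exact h0
  refine le_trans ?_ (le_measureReal_isPairwiseIsometry hN hMpos hh hκ0 hκ1
    (fun δ hδ => mul_sq_le_one_sub_windowPower hN hh hS hz.le (by linarith) hD hδ) hε hεN')
  have hcount := two_mul_net_bound_le_exp (n := N) (k := κ⁻¹) (e := ε⁻¹) (by positivity) hpi1 hL8
    (by positivity) (by positivity) hNL hκi hεL
  rw [← hC₁] at hcount
  have hfin : 2 * (1000 * N ^ 5 * κ⁻¹ ^ 2 * ε⁻¹) ^ 6 * Real.exp (-(1 / 4096 * ε ^ 2 * M))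
      ≤ Real.exp (-(1 / 8192 * ε ^ 2 * (M : ℝ))) := by
    calc _ ≤ Real.exp (C₁ * Real.log L) * Real.exp (-(1 / 4096 * ε ^ 2 * M)) := by gcongr
      _ = Real.exp (C₁ * Real.log L + -(1 / 4096 * ε ^ 2 * M)) := (Real.exp_add _ _).symm
      _ ≤ _ := by gcongr; linarith
  linarith
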